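/- **Bi-Hamiltonian structure of the Xue–Du–Geng (XDG) equation.** For constants $\alpha,\beta$, the XDG system for $u(x,t),v(x,t)$ is $$m_t=4(\partial_x m+m\partial_x)(v_x+2\beta v-u)+4n(u_x-2\beta u-4\alpha v)_x,\qquad n_t=4[n(v_x+2\beta v-u)]_x,$$ $$m=u_{xx}-4(\alpha+\beta^2)u,\qquad n=4(\alpha+\beta^2)v-v_{xx}.$$ Put $$\mathcal E_1=\begin{pmatrix} m\partial_x+\partial_x m& n\partial_x\\ \partial_x n&0\end{pmatrix},\qquad \mathcal E_2=\begin{pmatrix}-4\alpha\partial_x&-\partial_x^2-2\beta\partial_x\\ \partial_x^2-2\beta\partial_x&\partial_x\end{pmatrix}.$$ A Hamiltonian operator is a skew-adjoint matrix differential operator $\mathcal E$, with differential polynomial coefficients, for which the bracket $\{P,Q\}=\int\delta P\cdot\mathcal E\,\delta Q\,dx$ on local functionals (differential polynomials modulo total derivatives) satisfies the Jacobi identity; two operators form a compatible Hamiltonian pair if all their constant linear combinations are Hamiltonian. 1. *Compatible pair.* Over any field of characteristic $0$ (such as $\mathbb R$ or $\mathbb C$) and for all constants $\alpha,\beta$,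 the operators $\mathcal E_1,\mathcal E_2$ form a compatible Hamiltonian pair. The operators $$\mathcal B_1=\begin{pmatrix}-p\partial_x-\partial_x p&-\rho\partial_x\\-\partial_x\rho&0\end{pmatrix},\qquad \mathcal B_2=\begin{pmatrix}\partial_x^3-\partial_x&0\\0&\partial_x\end{pmatrix}$$ also form a compatible Hamiltonian pair. If $\kappa\neq0$ and $\kappa^2=4(\alpha+\beta^2)$, then $\mathcal E_1$ and the rescaled operator $$\mathcal E_2^{\kappa}=\frac1{\kappa^2}\begin{pmatrix}-4\alpha\partial_x&-\kappa\partial_x^2-2\beta\partial_x\\ \kappa\partial_x^2-2\beta\partial_x&\partial_x\end{pmatrix}$$ form a compatible Hamiltonian pair, and, with $p=-(\kappa n_x+2\beta n+m)$ and $\rho=\kappa n$, $$\mathcal B_1=\mathcal M\mathcal E_1\mathcal M^\dagger,\qquad \mathcal B_2=\mathcal M\mathcal E_2^{\kappa}\mathcal M^\dagger,\qquad \mathcal M=\begin{pmatrix}-1&-\kappa\partial_x-2\beta\\0&\kappa\end{pmatrix},\qquad \mathcal M^\dagger=\begin{pmatrix}-1&0\\ \kappa\partial_x-2\beta&\kappa\end{pmatrix},$$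 where $\mathcal M$ is the Fréchet derivative of the Miura map $(m,n)\mapsto(p,\rho)$ and $\mathcal M^\dagger$ is its formal adjoint. 2. *The XDG system.* Let $\alpha,\beta\in\mathbb R$, let $u,v$ be real Schwartz functions of $x$, and let $H_i=2\int_{-\infty}^{\infty}h_i\,dx$ $(i=1,2)$ with $$h_1=(v_x+2\beta v-u)(n_x+2\beta n+m)-n^2,$$ $$h_2=(u-v_x-2\beta v)\big[(v_{xx}+2\beta v_x-u_x)^2+4(\alpha+\beta^2)(v_x+2\beta v-u)^2-n^2\big].$$ A variational gradient $(\delta H/\delta m,\delta H/\delta n)$ of $H$ at $(u,v)$ is a pair of smooth functions of temperate growth such that the derivative of $H$ along every Schwartz variation is $\int(\frac{\delta H}{\delta m}\,\delta m+\frac{\delta H}{\delta n}\,\delta n)\,dx$. Then $h_1,h_2$ are integrable, and at each $(u,v)$ both $H_1$ and $H_2$ have variational gradients for which $$\mathcal E_1\begin{pmatrix}\delta H_1/\delta m\\ \delta H_1/\delta n\end{pmatrix}=\mathcal E_2\begin{pmatrix}\delta H_2/\delta m\\ \delta H_2/\delta n\end{pmatrix}$$ equals the right-hand side of the XDG system.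 If $\alpha+\beta^2>0$ (so that $m,n$ determine $u,v$ through an invertible operator), the variational gradients are unique. Consequently every solution $t\mapsto(u,v)$ of the XDG system in the Schwartz space satisfies $(m,n)^T_t=\mathcal E_1\,\delta H_1$ and $(m,n)^T_t=\mathcal E_2\,\delta H_2$ for suitable gradients, and if $\alpha+\beta^2>0$ each of these two equations is equivalent to the XDG system. 3. *The pair $\mathcal B_1,\mathcal B_2$.* On Schwartz functions $q,\rho$, the two-component Camassa–Holm equation $p_t+qp_x+2pq_x-\rho\rho_x=0$, $\rho_t+(\rho q)_x=0$, $p=q-q_{xx}$, is equivalent to each of the systems $(p,\rho)_t^T=\mathcal B_1\,\delta K_1$ and $(p,\rho)_t^T=\mathcal B_2\,\delta K_2$, where $\delta=(\delta/\delta p,\delta/\delta\rho)^T$, $K_1=\frac12\int(qp-\rho^2)\,dx$ and $K_2=\frac12\int q(q^2+q_x^2-\rho^2)\,dx$. -/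

import Mathlib

open scoped SchwartzMap ContDiff
open MeasureTheory

namespace XDG

/-! ### Matrix differential operators over a differential algebra

Throughout, `A` is a commutative algebra over a field `𝕜` with a derivation `d` (playing the role
of `∂ₓ`).  Scalar operators are elements of the ring `Module.End 𝕜 A`, whose product is
composition, and `2 × 2` matrix operators are matrices over that ring. -/

section Operators

variable {𝕜 A : Type*} [Field 𝕜] [CommRing A] [Algebra 𝕜 A]

/-- The operator `∂ₓ`. -/
def pd (d : Derivation 𝕜 A A) : Module.End 𝕜 A := (d : A →ₗ[𝕜] A)

/-- The operator of multiplication by `a`. -/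
def mulOp (𝕜 : Type*) {A : Type*} [Field 𝕜] [CommRing A] [Algebra 𝕜 A] (a : A) :
    Module.End 𝕜 A := LinearMap.mulLeft 𝕜 a

/-- Application of a matrix operator to a column vector. -/
def act (L : Matrix (Fin 2) (Fin 2) (Module.End 𝕜 A)) (f : Fin 2 → A) : Fin 2 → A :=
  fun i => ∑ j, L i j (f j)

/-- `E₁ = [[m∂ + ∂m, n∂], [∂n, 0]]`. -/
def E₁ (d : Derivation 𝕜 A A) (m n : A) : Matrix (Fin 2) (Fin 2) (Module.End 𝕜 A) :=
  !![mulOp 𝕜 m * pd d + pd d * mulOp 𝕜 m, mulOp 𝕜 n * pd d;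
     pd d * mulOp 𝕜 n, 0]

/-- `E₂ = [[-4α∂, -∂² - 2β∂], [∂² - 2β∂, ∂]]`. -/
def E₂ (d : Derivation 𝕜 A A) (α β : 𝕜) : Matrix (Fin 2) (Fin 2) (Module.End 𝕜 A) :=
  !![-((4 * α) • pd d), -(pd d ^ 2) - (2 * β) • pd d;
     pd d ^ 2 - (2 * β) • pd d, pd d]

/-- The operator `E₂` after rescaling:
`κ⁻² [[-4α∂, -κ∂² - 2β∂], [κ∂² - 2β∂, ∂]]`. -/
def E₂scaled (d : Derivation 𝕜 A A) (α β κ : 𝕜) :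
    Matrix (Fin 2) (Fin 2) (Module.End 𝕜 A) :=
  (κ ^ 2)⁻¹ •
    !![-((4 * α) • pd d), -(κ • pd d ^ 2) - (2 * β) • pd d;
       κ • pd d ^ 2 - (2 * β) • pd d, pd d]

/-- `B₁ = [[-p∂ - ∂p, -ρ∂], [-∂ρ, 0]]`. -/
def B₁ (d : Derivation 𝕜 A A) (p ρ : A) : Matrix (Fin 2) (Fin 2) (Module.End 𝕜 A) :=
  !![-(mulOp 𝕜 p * pd d) - pd d * mulOp 𝕜 p, -(mulOp 𝕜 ρ * pd d);
     -(pd d * mulOp 𝕜 ρ), 0]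

/-- `B₂ = [[∂³ - ∂, 0], [0, ∂]]`. -/
def B₂ (d : Derivation 𝕜 A A) : Matrix (Fin 2) (Fin 2) (Module.End 𝕜 A) :=
  !![pd d ^ 3 - pd d, 0;
     0, pd d]

/-- `M = [[-1, -κ∂ - 2β], [0, κ]]`. -/
def miuraOp (d : Derivation 𝕜 A A) (β κ : 𝕜) : Matrix (Fin 2) (Fin 2) (Module.End 𝕜 A) :=
  !![-1, -(κ • pd d) - (2 * β) • 1;
     0, κ • 1]

/-- `M† = [[-1, 0], [κ∂ - 2β, κ]]`. -/
def miuraOpAdj (d : Derivation 𝕜 A A) (β κ : 𝕜) :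
    Matrix (Fin 2) (Fin 2) (Module.End 𝕜 A) :=
  !![-1, 0;
     κ • pd d - (2 * β) • 1, κ • 1]

/-- The Miura map `p = -(κ nₓ + 2β n + m)`, `ρ = κ n`. -/
def miuraMap (d : Derivation 𝕜 A A) (β κ : 𝕜) (m n : A) : Fin 2 → A :=
  ![-(κ • d n + (2 * β) • n + m), κ • n]

/-! ### The XDG equation and the 2-CH equation -/

/-- The fields `m = uₓₓ - 4(α + β²)u` and `n = 4(α + β²)v - vₓₓ`. -/
def xdgFields (d : Derivation 𝕜 A A) (α β : 𝕜) (u v : A) : Fin 2 → A :=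
  ![d (d u) - (4 * (α + β ^ 2)) • u, (4 * (α + β ^ 2)) • v - d (d v)]

/-- The right-hand side of the XDG system:
`m_t = 4(∂m + m∂)(vₓ + 2βv - u) + 4n(uₓ - 2βu - 4αv)ₓ`, `n_t = 4[n(vₓ + 2βv - u)]ₓ`. -/
def xdgRHS (d : Derivation 𝕜 A A) (α β : 𝕜) (u v : A) : Fin 2 → A :=
  let m := xdgFields d α β u v 0
  let n := xdgFields d α β u v 1
  let w := d v + (2 * β) • v - u
  ![4 * (d (m * w) + m * d w) + 4 * n * d (d u - (2 * β) • u - (4 * α) • v),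
    4 * d (n * w)]

/-- `h₁ = (vₓ + 2βv - u)(nₓ + 2βn + m) - n²`. -/
def h₁ (d : Derivation 𝕜 A A) (α β : 𝕜) (u v : A) : A :=
  let m := xdgFields d α β u v 0
  let n := xdgFields d α β u v 1
  (d v + (2 * β) • v - u) * (d n + (2 * β) • n + m) - n ^ 2

/-- `h₂ = (u - vₓ - 2βv)[(vₓₓ + 2βvₓ - uₓ)² + 4(α + β²)(vₓ + 2βv - u)² - n²]`. -/
def h₂ (d : Derivation 𝕜 A A) (α β : 𝕜) (u v : A) : A :=
  let n := xdgFields d α β u v 1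
  (u - d v - (2 * β) • v) *
    ((d (d v) + (2 * β) • d v - d u) ^ 2
      + (4 * (α + β ^ 2)) • (d v + (2 * β) • v - u) ^ 2 - n ^ 2)

/-- The fields `p = q - qₓₓ` and `ρ` of the 2-CH equation. -/
def chFields (d : Derivation 𝕜 A A) (q ρ : A) : Fin 2 → A :=
  ![q - d (d q), ρ]

/-- The right-hand side of the 2-CH equation:
`p_t = -q pₓ - 2 p qₓ + ρ ρₓ`, `ρ_t = -(ρ q)ₓ`. -/
def chRHS (d : Derivation 𝕜 A A) (q ρ : A) : Fin 2 → A :=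
  let p := chFields d q ρ 0
  ![-(q * d p) - 2 * p * d q + ρ * d ρ, -d (ρ * q)]

/-- The density `q p - ρ²`. -/
def chDensity₁ (d : Derivation 𝕜 A A) (q ρ : A) : A :=
  q * chFields d q ρ 0 - ρ ^ 2

/-- The density `q (q² + qₓ² - ρ²)`. -/
def chDensity₂ (d : Derivation 𝕜 A A) (q ρ : A) : A :=
  q * (q ^ 2 + d q ^ 2 - ρ ^ 2)

end Operators

/-! ### Hamiltonian operators

The differential algebra of differential polynomials in two dependent variables, local functionals
modulo total derivatives, and the Poisson bracket defined by an operator. -/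

section Formal

variable {𝕜 : Type*} [Field 𝕜]

/-- Differential polynomials in two dependent variables; the variable `(i, k)` is the `k`-th
`x`-derivative of the `i`-th dependent variable. -/
abbrev Jet (𝕜 : Type*) [Field 𝕜] : Type _ := MvPolynomial (Fin 2 × ℕ) 𝕜

/-- The total derivative. -/
noncomputable def D (𝕜 : Type*) [Field 𝕜] : Derivation 𝕜 (Jet 𝕜) (Jet 𝕜) :=
  MvPolynomial.mkDerivation 𝕜 fun p => MvPolynomial.X (p.1, p.2 + 1)

/-- The `i`-th dependent variable. -/
noncomputable def fld (𝕜 : Type*) [Field 𝕜] (i : Fin 2) : Jet 𝕜 := MvPolynomial.X (i, 0)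

/-- `P` is a total derivative, i.e. the functional `∫ P dx` vanishes. -/
def IsTotalDeriv (P : Jet 𝕜) : Prop := ∃ Q, D 𝕜 Q = P

/-- The variational derivative (Euler operator) `∑ₖ (-D)ᵏ (∂P/∂uᵢ⁽ᵏ⁾)`; the orders `k` that are
left out of the sum do not occur in `P`. -/
noncomputable def varDeriv (P : Jet 𝕜) (i : Fin 2) : Jet 𝕜 :=
  ∑ k ∈ P.vars.image Prod.snd, ((-pd (D 𝕜)) ^ k) (MvPolynomial.pderiv (i, k) P)

/-- The Fréchet derivative of a pair of differential polynomials: the matrix operator with entries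
`∑ₖ (∂Pᵢ/∂uⱼ⁽ᵏ⁾) Dᵏ`. -/
noncomputable def frechet (P : Fin 2 → Jet 𝕜) :
    Matrix (Fin 2) (Fin 2) (Module.End 𝕜 (Jet 𝕜)) :=
  Matrix.of fun i j => ∑ k ∈ (P i).vars.image Prod.snd,
    mulOp 𝕜 (MvPolynomial.pderiv (j, k) (P i)) * pd (D 𝕜) ^ k

/-- The scalar differential operators: the subalgebra generated by `D` and multiplications. -/
noncomputable def diffOps (𝕜 : Type*) [Field 𝕜] : Subalgebra 𝕜 (Module.End 𝕜 (Jet 𝕜)) :=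
  Algebra.adjoin 𝕜 (insert (pd (D 𝕜)) (Set.range (mulOp 𝕜)))

/-- `L'` is the formal adjoint of `L`: `∫ P · L Q = ∫ Q · L' P` for all `P, Q`. -/
def IsFormalAdjoint (L L' : Matrix (Fin 2) (Fin 2) (Module.End 𝕜 (Jet 𝕜))) : Prop :=
  ∀ P Q : Fin 2 → Jet 𝕜, IsTotalDeriv (∑ i, P i * act L Q i - ∑ i, Q i * act L' P i)

/-- (A density of) the Poisson bracket `{∫P, ∫Q} = ∫ δP · L δQ`. -/
noncomputable def bracket (L : Matrix (Fin 2) (Fin 2) (Module.End 𝕜 (Jet 𝕜))) (P Q : Jet 𝕜) :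
    Jet 𝕜 :=
  ∑ i, varDeriv P i * act L (varDeriv Q) i

/-- A Hamiltonian operator: a skew-adjoint matrix differential operator whose bracket on local
functionals satisfies the Jacobi identity. -/
structure IsHamiltonian (L : Matrix (Fin 2) (Fin 2) (Module.End 𝕜 (Jet 𝕜))) : Prop where
  diffOp : ∀ i j, L i j ∈ diffOps 𝕜
  skew : IsFormalAdjoint L (-L)
  jacobi : ∀ P Q R : Jet 𝕜, IsTotalDeriv
    (bracket L (bracket L P Q) R + bracket L (bracket L Q R) P + bracket L (bracket L R P) Q)

/-- A compatible pair of Hamiltonian operators: every linear combination (in particular each of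
the two operators) is Hamiltonian. -/
def IsHamiltonianPair (L₁ L₂ : Matrix (Fin 2) (Fin 2) (Module.End 𝕜 (Jet 𝕜))) : Prop :=
  ∀ a b : 𝕜, IsHamiltonian (a • L₁ + b • L₂)

end Formal

/-! ### Functionals on Schwartz functions and their variational derivatives -/

/-- Smooth real functions on the line. -/
def Smooth : Subalgebra ℝ (ℝ → ℝ) where
  carrier := {f | ContDiff ℝ (∞ : WithTop ℕ∞) f}
  mul_mem' hf hg := ContDiff.mul (show ContDiff ℝ ∞ _ from hf) (show ContDiff ℝ ∞ _ from hg)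
  add_mem' hf hg := ContDiff.add (show ContDiff ℝ ∞ _ from hf) (show ContDiff ℝ ∞ _ from hg)
  algebraMap_mem' c := show ContDiff ℝ ∞ (fun _ : ℝ => c) from contDiff_const

theorem Smooth.contDiff (f : Smooth) : ContDiff ℝ ∞ f.1 := f.2

theorem Smooth.differentiableAt (f : Smooth) (x : ℝ) : DifferentiableAt ℝ f.1 x :=
  ((Smooth.contDiff f).differentiable (by simp)) x

/-- Differentiation of smooth functions. -/
noncomputable def dx : Derivation ℝ Smooth Smooth :=
  Derivation.mk'
    { toFun := fun f => ⟨deriv f.1, ContDiff.iterate_deriv 1 (Smooth.contDiff f)⟩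
      map_add' := fun f g => Subtype.ext <| funext fun x =>
        deriv_add (Smooth.differentiableAt f x) (Smooth.differentiableAt g x)
      map_smul' := fun c f => Subtype.ext <| funext fun x =>
        deriv_const_mul c (Smooth.differentiableAt f x) }
    (fun f g => Subtype.ext <| funext fun x => by
      refine (deriv_mul (Smooth.differentiableAt f x) (Smooth.differentiableAt g x)).trans ?_
      change _ = f.1 x * deriv g.1 x + g.1 x * deriv f.1 x
      ring)

/-- A Schwartz function as a smooth function. -/
noncomputable def toSmooth (f : 𝓢(ℝ, ℝ)) : Smooth := ⟨f, f.smooth'⟩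

/-- Let the fields `(m, n) = Λ (u, v)` be given by a linear map `Λ`.  The pair `g` (smooth, of
temperate growth) is a variational gradient `(δH/δm, δH/δn)` of `H` at `(u, v)`: the derivative of
`H` along every Schwartz variation `(U, V)` is
`∫ (g₀ δm + g₁ δn) dx` with `(δm, δn) = Λ (U, V)`. -/
def IsVarGradient (Λ : Smooth → Smooth → Fin 2 → Smooth) (H : 𝓢(ℝ, ℝ) → 𝓢(ℝ, ℝ) → ℝ)
    (u v : 𝓢(ℝ, ℝ)) (g : Fin 2 → Smooth) : Prop :=
  (∀ i, Function.HasTemperateGrowth (g i).1) ∧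
  ∀ U V : 𝓢(ℝ, ℝ), HasDerivAt (fun ε : ℝ => H (u + ε • U) (v + ε • V))
    (∫ x, ∑ i, (g i).1 x * (Λ (toSmooth U) (toSmooth V) i).1 x) 0

/-- The fields `Λ (u, v)` evolve in time by the vector field `F`. -/
def Evolves (Λ : Smooth → Smooth → Fin 2 → Smooth) (F : ℝ → Fin 2 → Smooth)
    (u v : ℝ → 𝓢(ℝ, ℝ)) : Prop :=
  ∀ (t : ℝ) (i : Fin 2) (x : ℝ),
    HasDerivAt (fun s => (Λ (toSmooth (u s)) (toSmooth (v s)) i).1 x) ((F t i).1 x) t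

/-- `(u, v)` solves the Hamiltonian system `(m, n)_t = E (δH/δm, δH/δn)`, where
`(m, n) = Λ (u, v)` and `E` may depend on `(m, n)`. -/
def IsHamiltonianFlow (Λ : Smooth → Smooth → Fin 2 → Smooth)
    (E : (Fin 2 → Smooth) → Matrix (Fin 2) (Fin 2) (Module.End ℝ Smooth))
    (H : 𝓢(ℝ, ℝ) → 𝓢(ℝ, ℝ) → ℝ) (u v : ℝ → 𝓢(ℝ, ℝ)) : Prop :=
  ∃ g : ℝ → Fin 2 → Smooth, (∀ t, IsVarGradient Λ H (u t) (v t) (g t)) ∧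
    Evolves Λ (fun t => act (E (Λ (toSmooth (u t)) (toSmooth (v t)))) (g t)) u v

/-- `(u, v)` solves the XDG system. -/
def IsXDGSolution (α β : ℝ) (u v : ℝ → 𝓢(ℝ, ℝ)) : Prop :=
  Evolves (xdgFields dx α β) (fun t => xdgRHS dx α β (toSmooth (u t)) (toSmooth (v t))) u v

/-- `(q, ρ)` solves the 2-CH equation. -/
def IsCHSolution (q ρ : ℝ → 𝓢(ℝ, ℝ)) : Prop :=
  Evolves (chFields dx) (fun t => chRHS dx (toSmooth (q t)) (toSmooth (ρ t))) q ρ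

/-- `H₁ = 2 ∫ h₁ dx`. -/
noncomputable def H₁ (α β : ℝ) (u v : 𝓢(ℝ, ℝ)) : ℝ :=
  2 * ∫ x, (h₁ dx α β (toSmooth u) (toSmooth v)).1 x

/-- `H₂ = 2 ∫ h₂ dx`. -/
noncomputable def H₂ (α β : ℝ) (u v : 𝓢(ℝ, ℝ)) : ℝ :=
  2 * ∫ x, (h₂ dx α β (toSmooth u) (toSmooth v)).1 x

/-- `½ ∫ (q p - ρ²) dx`. -/
noncomputable def chH₁ (q ρ : 𝓢(ℝ, ℝ)) : ℝ :=
  (1 / 2) * ∫ x, (chDensity₁ dx (toSmooth q) (toSmooth ρ)).1 x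

/-- `½ ∫ q (q² + qₓ² - ρ²) dx`. -/
noncomputable def chH₂ (q ρ : 𝓢(ℝ, ℝ)) : ℝ :=
  (1 / 2) * ∫ x, (chDensity₂ dx (toSmooth q) (toSmooth ρ)).1 x

end XDG

open XDG

/-!
The Jacobi identity, bi-Hamiltonian form and Miura relation of the Xue-Du-Geng system.

*Hamiltonian pairs.* All operators in question are instances of one pencil `a E₁ + C`, where `C` is
a skew-adjoint operator with constant coefficients (`pencil`).  Write `≡` for equality modulo total
derivatives, `v_K` for the evolutionary derivation with characteristic `K`, and `K_P = L δP`.  By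
the first variation formula (`evol_sub_mem`) `{{P, Q}, R} ≡ v_{K_R} {P, Q}`.  Differentiating
`{P, Q} = δP · L δQ` and using skew-adjointness gives
`{{P, Q}, R} ≡ K_Q · v_{K_R} δP - K_P · v_{K_R} δQ + δP · (v_{K_R} L) δQ`
(`bracket_bracket_mem`).  In the cyclic sum the first two kinds of terms cancel because the Fréchet
derivative of a variational derivative is self-adjoint (`varDeriv_helmholtz`), which in turn
follows from the commutation rule of evolutionary derivations.  As `E₁` is linear in the fields,
`v_K L` is `a E₁` with `K` in place of the fields, and the remaining sum is a total derivative
(`pencil_cyclic`): `E₁` is the Lie-Poisson operator of the Lie algebra of pairs with bracket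
`(f₀ g₀' - f₀' g₀, f₀ g₁' - f₁' g₀)` and `C` is a `2`-cocycle of that algebra.

*Variational gradients.* With `w = vₓ + 2βv - u` and `c = 4(α + β²)` one has
`h₁ = w (c w - wₓₓ) - n²`, `h₂ = -w (wₓ² + c w² - n²)` and `m = c w - wₓₓ - nₓ - 2βn`.  The gradient
of `H₁` is local.  That of `H₂` requires a solution `G` of `c G - Gₓₓ = wₓ² + 2wwₓₓ - 3c w² + n²` of
temperate growth; one exists for every real `c` (`exists_temperate_ode`), by factoring the operator
into first order ones, and the identity `E₂ δH₂ = RHS` only uses the equation for `G`.  Along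
a variation the densities are cubic polynomials in the parameter, so that gradients can be read off
from the linear coefficient up to total derivatives (`isVarGradient_of_expansion`).  For `c > 0`
two gradients differ by functions `δ` of temperate growth with `δₓₓ = c δ`, which vanish as no
nonzero exponential is polynomially bounded (`eq_zero_of_temperate_of_ode`).  The 2-CH equation is
treated in the same way with `c = 1`.
-/

/-! ### A pencil of skew-adjoint operators -/

namespace XDG

section Formal

variable {𝕜 A : Type*} [Field 𝕜] [CommRing A] [Algebra 𝕜 A]

@[simp] theorem pd_apply (d : Derivation 𝕜 A A) (a : A) : pd d a = d a := rfl

@[simp] theorem mulOp_apply (a b : A) : mulOp 𝕜 a b = a * b := rfl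

/-- The skew-adjoint operators `[[c₁∂ + c₅∂³, c₃∂ - c₂∂²], [c₃∂ + c₂∂², c₄∂]]` with constant
coefficients; `E₂`, its rescaling and `B₂` all have this shape. -/
def constOp (d : Derivation 𝕜 A A) (c₁ c₂ c₃ c₄ c₅ : 𝕜) :
    Matrix (Fin 2) (Fin 2) (Module.End 𝕜 A) :=
  !![c₁ • pd d + c₅ • pd d ^ 3, c₃ • pd d - c₂ • pd d ^ 2;
     c₃ • pd d + c₂ • pd d ^ 2, c₄ • pd d]

theorem act_E₁_zero (d : Derivation 𝕜 A A) (m n : A) (f : Fin 2 → A) :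
    act (E₁ d m n) f 0 = m * d (f 0) + d (m * f 0) + n * d (f 1) := by
  simp [act, E₁, Fin.sum_univ_two]

theorem act_E₁_one (d : Derivation 𝕜 A A) (m n : A) (f : Fin 2 → A) :
    act (E₁ d m n) f 1 = d (n * f 0) := by
  simp [act, E₁, Fin.sum_univ_two]

theorem act_constOp_zero (d : Derivation 𝕜 A A) (c₁ c₂ c₃ c₄ c₅ : 𝕜) (f : Fin 2 → A) :
    act (constOp d c₁ c₂ c₃ c₄ c₅) f 0 =
      c₁ • d (f 0) + c₅ • d (d (d (f 0))) + (c₃ • d (f 1) - c₂ • d (d (f 1))) := by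
  simp [act, constOp, Fin.sum_univ_two, pow_succ]

theorem act_constOp_one (d : Derivation 𝕜 A A) (c₁ c₂ c₃ c₄ c₅ : 𝕜) (f : Fin 2 → A) :
    act (constOp d c₁ c₂ c₃ c₄ c₅) f 1 =
      c₃ • d (f 0) + c₂ • d (d (f 0)) + c₄ • d (f 1) := by
  simp [act, constOp, Fin.sum_univ_two, pow_succ]

theorem act_add (L L' : Matrix (Fin 2) (Fin 2) (Module.End 𝕜 A)) (f : Fin 2 → A) (i : Fin 2) :
    act (L + L') f i = act L f i + act L' f i := by
  simp [act, Finset.sum_add_distrib]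

theorem act_smul (a : 𝕜) (L : Matrix (Fin 2) (Fin 2) (Module.End 𝕜 A)) (f : Fin 2 → A)
    (i : Fin 2) : act (a • L) f i = a • act L f i := by
  simp [act]

theorem act_neg (L : Matrix (Fin 2) (Fin 2) (Module.End 𝕜 A)) (f : Fin 2 → A) (i : Fin 2) :
    act (-L) f i = -act L f i := by
  simp [act]

/-- The operators `a E₁ + C` with `C` of constant coefficients. -/
def pencil (d : Derivation 𝕜 A A) (m n : A) (a c₁ c₂ c₃ c₄ c₅ : 𝕜) :
    Matrix (Fin 2) (Fin 2) (Module.End 𝕜 A) :=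
  a • E₁ d m n + constOp d c₁ c₂ c₃ c₄ c₅

theorem act_pencil_zero (d : Derivation 𝕜 A A) (m n : A) (a c₁ c₂ c₃ c₄ c₅ : 𝕜)
    (f : Fin 2 → A) : act (pencil d m n a c₁ c₂ c₃ c₄ c₅) f 0 =
      a • (m * d (f 0) + d (m * f 0) + n * d (f 1)) +
        (c₁ • d (f 0) + c₅ • d (d (d (f 0))) + (c₃ • d (f 1) - c₂ • d (d (f 1)))) := by
  rw [pencil, act_add, act_smul, act_E₁_zero, act_constOp_zero]

theorem act_pencil_one (d : Derivation 𝕜 A A) (m n : A) (a c₁ c₂ c₃ c₄ c₅ : 𝕜)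
    (f : Fin 2 → A) : act (pencil d m n a c₁ c₂ c₃ c₄ c₅) f 1 =
      a • d (n * f 0) + (c₃ • d (f 0) + c₂ • d (d (f 0)) + c₄ • d (f 1)) := by
  rw [pencil, act_add, act_smul, act_E₁_one, act_constOp_one]

/-- The pencil is skew-adjoint: `f · L g + g · L f` is a total derivative. -/
theorem pencil_skew (d : Derivation 𝕜 A A) (m n : A) (a c₁ c₂ c₃ c₄ c₅ : 𝕜)
    (f g : Fin 2 → A) : ∃ Q, d Q =
      ∑ i, f i * act (pencil d m n a c₁ c₂ c₃ c₄ c₅) g i +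
        ∑ i, g i * act (pencil d m n a c₁ c₂ c₃ c₄ c₅) f i := by
  refine ⟨a • (m * f 0 * g 0 + m * f 0 * g 0 + n * f 0 * g 1 + n * f 1 * g 0) + c₁ • (f 0 * g 0)
    + c₅ • (f 0 * d (d (g 0)) - d (f 0) * d (g 0) + d (d (f 0)) * g 0)
    + c₃ • (f 0 * g 1 + f 1 * g 0)
    + c₂ • (f 1 * d (g 0) - d (f 1) * g 0 - f 0 * d (g 1) + d (f 0) * g 1)
    + c₄ • (f 1 * g 1), ?_⟩
  simp only [Fin.sum_univ_two, act_pencil_zero, act_pencil_one, map_add, map_sub,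
    Derivation.leibniz, smul_eq_mul, Algebra.smul_def]
  simp
  ring

/-- The Jacobi identity of the pencil on arbitrary triples `f, g, h`.  Up to the factor `a`, the
operator `E₁` with fields `L h` is the derivative of the pencil along `L h`.  Up to total
derivatives the sum pairs `L h` with the Lie bracket
`[f, g] = (f₀ g₀' - f₀' g₀, f₀ g₁' - f₁' g₀)`, for which `E₁` is the Lie-Poisson operator and the
constant coefficient operators are `2`-cocycles. -/
theorem pencil_cyclic (d : Derivation 𝕜 A A) (m n : A) (a c₁ c₂ c₃ c₄ c₅ : 𝕜)
    (f g h : Fin 2 → A) (L : Matrix (Fin 2) (Fin 2) (Module.End 𝕜 A))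
    (hL : L = pencil d m n a c₁ c₂ c₃ c₄ c₅) : ∃ Q, d Q =
      ∑ i, f i * act (E₁ d (act L h 0) (act L h 1)) g i +
      ∑ i, g i * act (E₁ d (act L f 0) (act L f 1)) h i +
      ∑ i, h i * act (E₁ d (act L g 0) (act L g 1)) f i := by
  subst hL
  obtain ⟨w, hw⟩ : ∃ w : (Fin 2 → A) → (Fin 2 → A) → Fin 2 → A, w = fun f g =>
      ![f 0 * d (g 0) - d (f 0) * g 0, f 0 * d (g 1) - d (f 1) * g 0] := ⟨_, rfl⟩
  have hw0 (f g) : w f g 0 = f 0 * d (g 0) - d (f 0) * g 0 := by simp [hw]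
  have hw1 (f g) : w f g 1 = f 0 * d (g 1) - d (f 1) * g 0 := by simp [hw]
  set L := pencil d m n a c₁ c₂ c₃ c₄ c₅
  refine ⟨act L h 0 * f 0 * g 0 + act L h 1 * f 1 * g 0
    + (act L f 0 * g 0 * h 0 + act L f 1 * g 1 * h 0)
    + (act L g 0 * h 0 * f 0 + act L g 1 * h 1 * f 0)
    + a • (m * h 0 * w f g 0 + n * h 0 * w f g 1 + (m * f 0 * w g h 0 + n * f 0 * w g h 1)
      + (m * g 0 * w h f 0 + n * g 0 * w h f 1))
    - c₂ • (d (f 1) * w g h 0 + d (g 1) * w h f 0 + d (h 1) * w f g 0)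
    + c₅ • (d (d (h 0)) * w f g 0 + d (d (f 0)) * w g h 0 + d (d (g 0)) * w h f 0), ?_⟩
  simp only [L, Fin.sum_univ_two, act_pencil_zero, act_pencil_one, act_E₁_zero, act_E₁_one,
    hw0, hw1, map_add, map_sub,
    Derivation.leibniz, smul_eq_mul, Algebra.smul_def]
  simp
  ring

end Formal

end XDG

/-! ### Evolutionary derivations and the Jacobi identity -/

namespace XDG

section Jets

variable {𝕜 : Type*} [Field 𝕜]

/-- Total derivatives, as a subspace. -/
noncomputable def totalDerivs (𝕜 : Type*) [Field 𝕜] : Submodule 𝕜 (Jet 𝕜) :=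
  LinearMap.range (pd (D 𝕜))

theorem D_mem (P : Jet 𝕜) : D 𝕜 P ∈ totalDerivs 𝕜 := ⟨P, rfl⟩

@[simp] theorem D_X (p : Fin 2 × ℕ) :
    D 𝕜 (MvPolynomial.X p) = MvPolynomial.X (p.1, p.2 + 1) :=
  MvPolynomial.mkDerivation_X ..

/-- The evolutionary derivation with characteristic `K`: the derivation that commutes with the
total derivative and sends the `i`-th dependent variable to `K i`. -/
noncomputable def evol (K : Fin 2 → Jet 𝕜) : Derivation 𝕜 (Jet 𝕜) (Jet 𝕜) :=
  MvPolynomial.mkDerivation 𝕜 fun p => (pd (D 𝕜) ^ p.2) (K p.1)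

theorem evol_X (K : Fin 2 → Jet 𝕜) (p : Fin 2 × ℕ) :
    evol K (MvPolynomial.X p) = (pd (D 𝕜) ^ p.2) (K p.1) :=
  MvPolynomial.mkDerivation_X ..

@[simp] theorem evol_fld (K : Fin 2 → Jet 𝕜) (i : Fin 2) : evol K (fld 𝕜 i) = K i := by
  simp [fld, evol_X]

theorem evol_D (K : Fin 2 → Jet 𝕜) (P : Jet 𝕜) : evol K (D 𝕜 P) = D 𝕜 (evol K P) := by
  have h : ⁅evol K, D 𝕜⁆ = 0 := by
    refine MvPolynomial.derivation_ext fun p => ?_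
    rw [Derivation.commutator_apply, D_X, evol_X, evol_X, pow_succ']
    simp
  simpa [Derivation.commutator_apply, sub_eq_zero] using congr($h P)

theorem evol_mem {K : Fin 2 → Jet 𝕜} {P : Jet 𝕜} (h : P ∈ totalDerivs 𝕜) :
    evol K P ∈ totalDerivs 𝕜 := by
  obtain ⟨Q, rfl⟩ := h
  rw [pd_apply, evol_D]
  exact D_mem _

theorem evol_commutator (K J : Fin 2 → Jet 𝕜) (P : Jet 𝕜) :
    evol K (evol J P) - evol J (evol K P) =
      evol (fun i => evol K (J i) - evol J (K i)) P := by
  have hpow (K J : Fin 2 → Jet 𝕜) (k : ℕ) (i : Fin 2) :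
      evol K ((pd (D 𝕜) ^ k) (J i)) = (pd (D 𝕜) ^ k) (evol K (J i)) := by
    induction k with
    | zero => rfl
    | succ k ih => simp only [pow_succ', Module.End.mul_apply, pd_apply, evol_D, ih]
  have h : ⁅evol K, evol J⁆ = evol (fun i => evol K (J i) - evol J (K i)) := by
    refine MvPolynomial.derivation_ext fun p => ?_
    rw [Derivation.commutator_apply, evol_X, evol_X, evol_X, hpow, hpow, map_sub]
  simpa [Derivation.commutator_apply] using congr($h P)

theorem pderiv_eq_zero_of_notMem {P : Jet 𝕜} {k : ℕ} (hk : k ∉ P.vars.image Prod.snd)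
    (i : Fin 2) : MvPolynomial.pderiv (i, k) P = 0 :=
  MvPolynomial.pderiv_eq_zero_of_notMem_vars fun h => hk (Finset.mem_image_of_mem _ h)

theorem derivation_sum_apply {ι : Type*} (s : Finset ι)
    (δ : ι → Derivation 𝕜 (Jet 𝕜) (Jet 𝕜)) (P : Jet 𝕜) : (∑ i ∈ s, δ i) P = ∑ i ∈ s, δ i P := by
  rw [← Derivation.coeFnAddMonoidHom_apply, map_sum, Finset.sum_apply]
  rfl

/-- The chain rule `v_K P = ∑ᵢₖ ∂P/∂uᵢ⁽ᵏ⁾ · Dᵏ Kᵢ`. -/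
theorem evol_eq_sum (K : Fin 2 → Jet 𝕜) (P : Jet 𝕜) :
    evol K P = ∑ i, ∑ k ∈ P.vars.image Prod.snd,
      MvPolynomial.pderiv (i, k) P * (pd (D 𝕜) ^ k) (K i) := by
  classical
  set s := P.vars.image Prod.snd
  have h := MvPolynomial.derivation_eq_of_forall_mem_vars (D₁ := evol K)
    (D₂ := ∑ i, ∑ k ∈ s, (pd (D 𝕜) ^ k) (K i) • MvPolynomial.pderiv (i, k)) (f := P) ?_
  · rw [h]
    simp only [derivation_sum_apply, Derivation.smul_apply, smul_eq_mul, mul_comm]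
  · rintro ⟨i, k⟩ hp
    have hk : k ∈ s := Finset.mem_image_of_mem _ hp
    simp only [derivation_sum_apply, Derivation.smul_apply, smul_eq_mul, evol_X,
      MvPolynomial.pderiv_X]
    rw [Finset.sum_eq_single i, Finset.sum_eq_single k]
    · simp
    · intro b _ hb
      simp [hb.symm]
    · exact fun h => absurd hk h
    · intro b _ hb
      refine Finset.sum_eq_zero fun l _ => ?_
      simp [hb.symm]
    · simp

theorem mul_pow_sub_mem (P Q : Jet 𝕜) (k : ℕ) :
    P * (pd (D 𝕜) ^ k) Q - Q * ((-pd (D 𝕜)) ^ k) P ∈ totalDerivs 𝕜 := by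
  induction k generalizing P Q with
  | zero => simp [mul_comm]
  | succ k ih =>
    have h := add_mem (ih P (D 𝕜 Q)) (D_mem (Q * ((-pd (D 𝕜)) ^ k) P))
    convert h using 1
    simp only [pow_succ, pow_succ' (-pd (D 𝕜)), Module.End.mul_apply, LinearMap.neg_apply,
      pd_apply, Derivation.leibniz, smul_eq_mul]
    ring

/-- The first variation formula: modulo total derivatives, `v_K P` is `∑ Kᵢ δP/δuᵢ`. -/
theorem evol_sub_mem (K : Fin 2 → Jet 𝕜) (P : Jet 𝕜) :
    evol K P - ∑ i, K i * varDeriv P i ∈ totalDerivs 𝕜 := by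
  rw [evol_eq_sum, ← Finset.sum_sub_distrib]
  refine Submodule.sum_mem _ fun i _ => ?_
  rw [varDeriv, Finset.mul_sum, ← Finset.sum_sub_distrib]
  exact Submodule.sum_mem _ fun k _ => mul_pow_sub_mem _ _ _

/-- The Helmholtz condition: the Fréchet derivative of a variational derivative is formally
self-adjoint. -/
theorem varDeriv_helmholtz (K J : Fin 2 → Jet 𝕜) (P : Jet 𝕜) :
    ∑ i, J i * evol K (varDeriv P i) - ∑ i, K i * evol J (varDeriv P i) ∈ totalDerivs 𝕜 := by
  have h₁ := evol_mem (K := K) (evol_sub_mem J P)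
  have h₂ := evol_mem (K := J) (evol_sub_mem K P)
  have h₃ := evol_sub_mem (fun i => evol K (J i) - evol J (K i)) P
  rw [← evol_commutator] at h₃
  convert sub_mem (add_mem h₃ h₂) h₁ using 1
  simp only [Fin.sum_univ_two, map_sub, map_add, Derivation.leibniz, smul_eq_mul]
  ring

/-- The pencil on jets. -/
noncomputable abbrev jetPencil (a c₁ c₂ c₃ c₄ c₅ : 𝕜) :
    Matrix (Fin 2) (Fin 2) (Module.End 𝕜 (Jet 𝕜)) :=
  pencil (D 𝕜) (fld 𝕜 0) (fld 𝕜 1) a c₁ c₂ c₃ c₄ c₅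

theorem evol_act_jetPencil (a c₁ c₂ c₃ c₄ c₅ : 𝕜) (K f : Fin 2 → Jet 𝕜) (i : Fin 2) :
    evol K (act (jetPencil a c₁ c₂ c₃ c₄ c₅) f i) =
      act (jetPencil a c₁ c₂ c₃ c₄ c₅) (fun j => evol K (f j)) i +
        a • act (E₁ (D 𝕜) (K 0) (K 1)) f i := by
  fin_cases i
  · simp only [Fin.zero_eta, jetPencil, act_pencil_zero, act_E₁_zero, map_add, map_sub,
      evol_D, Derivation.leibniz, smul_eq_mul, evol_fld, Algebra.smul_def]
    simp
    ring
  · simp only [Fin.mk_one, jetPencil, act_pencil_one, act_E₁_one, map_add,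
      evol_D, Derivation.leibniz, smul_eq_mul, evol_fld, Algebra.smul_def]
    simp
    ring

/-- One term of the Jacobi identity: up to total derivatives it is a difference of two terms of
Helmholtz type and a contribution of the field dependence of the operator. -/
theorem bracket_bracket_mem (a c₁ c₂ c₃ c₄ c₅ : 𝕜) (P Q R : Jet 𝕜)
    (L : Matrix (Fin 2) (Fin 2) (Module.End 𝕜 (Jet 𝕜))) (hL : L = jetPencil a c₁ c₂ c₃ c₄ c₅) :
    bracket L (bracket L P Q) R -
      (∑ i, act L (varDeriv Q) i * evol (act L (varDeriv R)) (varDeriv P i) -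
        ∑ i, act L (varDeriv P) i * evol (act L (varDeriv R)) (varDeriv Q i) +
        a • ∑ i, varDeriv P i *
          act (E₁ (D 𝕜) (act L (varDeriv R) 0) (act L (varDeriv R) 1)) (varDeriv Q) i) ∈
      totalDerivs 𝕜 := by
  set K := act L (varDeriv R)
  have h₁ := evol_sub_mem K (bracket L P Q)
  obtain ⟨W, h₂⟩ := pencil_skew (D 𝕜) (fld 𝕜 0) (fld 𝕜 1) a c₁ c₂ c₃ c₄ c₅
    (varDeriv P) (fun j => evol K (varDeriv Q j))
  have h₂ : _ ∈ totalDerivs 𝕜 := ⟨W, h₂⟩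
  change ∑ i, varDeriv P i * act (jetPencil a c₁ c₂ c₃ c₄ c₅) _ i + _ ∈ _ at h₂
  rw [← hL] at h₂
  have h₃ : evol K (bracket L P Q) = ∑ i, (act L (varDeriv Q) i * evol K (varDeriv P i) +
      varDeriv P i * (act L (fun j => evol K (varDeriv Q j)) i +
        a • act (E₁ (D 𝕜) (K 0) (K 1)) (varDeriv Q) i)) := by
    rw [bracket, map_sum]
    refine Finset.sum_congr rfl fun i _ => ?_
    rw [hL, ← evol_act_jetPencil, Derivation.leibniz, smul_eq_mul, smul_eq_mul, add_comm]
  convert sub_mem h₂ h₁ using 1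
  rw [h₃, bracket]
  simp only [Fin.sum_univ_two, Algebra.smul_def, ← hL]
  ring

theorem jetPencil_jacobi (a c₁ c₂ c₃ c₄ c₅ : 𝕜) (P Q R : Jet 𝕜)
    (L : Matrix (Fin 2) (Fin 2) (Module.End 𝕜 (Jet 𝕜))) (hL : L = jetPencil a c₁ c₂ c₃ c₄ c₅) :
    bracket L (bracket L P Q) R + bracket L (bracket L Q R) P + bracket L (bracket L R P) Q ∈
      totalDerivs 𝕜 := by
  have h₁ := bracket_bracket_mem a c₁ c₂ c₃ c₄ c₅ P Q R L hL
  have h₂ := bracket_bracket_mem a c₁ c₂ c₃ c₄ c₅ Q R P L hL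
  have h₃ := bracket_bracket_mem a c₁ c₂ c₃ c₄ c₅ R P Q L hL
  have k₁ := varDeriv_helmholtz (act L (varDeriv R)) (act L (varDeriv Q)) P
  have k₂ := varDeriv_helmholtz (act L (varDeriv P)) (act L (varDeriv R)) Q
  have k₃ := varDeriv_helmholtz (act L (varDeriv Q)) (act L (varDeriv P)) R
  obtain ⟨W, hW⟩ := pencil_cyclic (D 𝕜) (fld 𝕜 0) (fld 𝕜 1) a c₁ c₂ c₃ c₄ c₅
    (varDeriv P) (varDeriv Q) (varDeriv R) L hL
  have h₄ := (totalDerivs 𝕜).smul_mem a (⟨W, hW⟩ : _ ∈ totalDerivs 𝕜)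
  convert add_mem (add_mem (add_mem (add_mem h₁ h₂) h₃) (add_mem (add_mem k₁ k₂) k₃)) h₄ using 1
  simp only [Algebra.smul_def]
  ring

theorem pd_mem_diffOps : pd (D 𝕜) ∈ diffOps 𝕜 :=
  Algebra.subset_adjoin (Set.mem_insert _ _)

theorem mulOp_mem_diffOps (P : Jet 𝕜) : mulOp 𝕜 P ∈ diffOps 𝕜 :=
  Algebra.subset_adjoin (Set.mem_insert_of_mem _ ⟨P, rfl⟩)

theorem jetPencil_mem_diffOps (a c₁ c₂ c₃ c₄ c₅ : 𝕜) (i j : Fin 2) :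
    jetPencil a c₁ c₂ c₃ c₄ c₅ i j ∈ diffOps 𝕜 := by
  have hd := pd_mem_diffOps (𝕜 := 𝕜)
  have hm (P : Jet 𝕜) := mulOp_mem_diffOps P
  have hs (c : 𝕜) {T : Module.End 𝕜 (Jet 𝕜)} (hT : T ∈ diffOps 𝕜) : c • T ∈ diffOps 𝕜 :=
    Subalgebra.smul_mem _ hT c
  fin_cases i <;> fin_cases j <;>
    simp only [pencil, E₁, constOp, Matrix.add_apply, Matrix.smul_apply, Matrix.of_apply,
      Matrix.cons_val', Matrix.cons_val_zero, Matrix.cons_val_one, Fin.zero_eta, Fin.mk_one,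
      Matrix.cons_val_fin_one]
  · exact add_mem (hs _ (add_mem (mul_mem (hm _) hd) (mul_mem hd (hm _))))
      (add_mem (hs _ hd) (hs _ (pow_mem hd _)))
  · exact add_mem (hs _ (mul_mem (hm _) hd)) (sub_mem (hs _ hd) (hs _ (pow_mem hd _)))
  · exact add_mem (hs _ (mul_mem hd (hm _))) (add_mem (hs _ hd) (hs _ (pow_mem hd _)))
  · exact add_mem (hs _ (zero_mem _)) (hs _ hd)

theorem isHamiltonian_jetPencil (a c₁ c₂ c₃ c₄ c₅ : 𝕜) :
    IsHamiltonian (jetPencil a c₁ c₂ c₃ c₄ c₅) where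
  diffOp := jetPencil_mem_diffOps a c₁ c₂ c₃ c₄ c₅
  skew f g := by
    obtain ⟨W, hW⟩ := pencil_skew (D 𝕜) (fld 𝕜 0) (fld 𝕜 1) a c₁ c₂ c₃ c₄ c₅ f g
    exact ⟨W, by simpa only [act_neg, mul_neg, Finset.sum_neg_distrib, sub_neg_eq_add] using hW⟩
  jacobi P Q R := jetPencil_jacobi a c₁ c₂ c₃ c₄ c₅ P Q R _ rfl

theorem isHamiltonianPair_of_eq {L₁ L₂ : Matrix (Fin 2) (Fin 2) (Module.End 𝕜 (Jet 𝕜))}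
    (s c₁ c₂ c₃ c₄ c₅ : 𝕜) (h₁ : L₁ = s • E₁ (D 𝕜) (fld 𝕜 0) (fld 𝕜 1))
    (h₂ : L₂ = constOp (D 𝕜) c₁ c₂ c₃ c₄ c₅) : IsHamiltonianPair L₁ L₂ := by
  intro a b
  have h : a • L₁ + b • L₂ =
      jetPencil (a * s) (b * c₁) (b * c₂) (b * c₃) (b * c₄) (b * c₅) := by
    rw [h₁, h₂, smul_smul, jetPencil, pencil]
    congr 1
    refine Matrix.ext fun i j => ?_
    fin_cases i <;> fin_cases j <;> simp [constOp] <;> module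
  rw [h]
  exact isHamiltonian_jetPencil ..

theorem isHamiltonianPair_E₁_E₂ (α β : 𝕜) :
    IsHamiltonianPair (E₁ (D 𝕜) (fld 𝕜 0) (fld 𝕜 1)) (E₂ (D 𝕜) α β) := by
  refine isHamiltonianPair_of_eq 1 (-(4 * α)) 1 (-(2 * β)) 1 0 (one_smul _ _).symm ?_
  refine Matrix.ext fun i j => ?_
  fin_cases i <;> fin_cases j <;> simp [constOp, E₂] <;> module

theorem isHamiltonianPair_E₁_E₂scaled (α β κ : 𝕜) :
    IsHamiltonianPair (E₁ (D 𝕜) (fld 𝕜 0) (fld 𝕜 1)) (E₂scaled (D 𝕜) α β κ) := by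
  refine isHamiltonianPair_of_eq 1 ((κ ^ 2)⁻¹ * -(4 * α)) ((κ ^ 2)⁻¹ * κ) ((κ ^ 2)⁻¹ * -(2 * β))
    (κ ^ 2)⁻¹ 0 (one_smul _ _).symm ?_
  refine Matrix.ext fun i j => ?_
  fin_cases i <;> fin_cases j <;> simp [constOp, E₂scaled] <;> module

theorem isHamiltonianPair_B₁_B₂ :
    IsHamiltonianPair (B₁ (D 𝕜) (fld 𝕜 0) (fld 𝕜 1)) (B₂ (D 𝕜)) := by
  refine isHamiltonianPair_of_eq (-1) (-1) 0 0 1 1 ?_ ?_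
  · refine Matrix.ext fun i j => ?_
    fin_cases i <;> fin_cases j <;> simp [E₁, B₁] <;> module
  · refine Matrix.ext fun i j => ?_
    fin_cases i <;> fin_cases j <;> simp [constOp, B₂]; module

end Jets

end XDG

/-! ### The Miura map -/

namespace XDG

section Miura

variable {𝕜 A : Type*} [Field 𝕜] [CommRing A] [Algebra 𝕜 A]

theorem frechet_apply_eq_sum (P : Fin 2 → Jet 𝕜) (i j : Fin 2) (s : Finset ℕ)
    (hs : ∀ k ∉ s, MvPolynomial.pderiv (j, k) (P i) = 0) :
    frechet P i j = ∑ k ∈ s, mulOp 𝕜 (MvPolynomial.pderiv (j, k) (P i)) * pd (D 𝕜) ^ k := by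
  have h0 : mulOp 𝕜 (0 : Jet 𝕜) = 0 := by ext1; simp [mulOp]
  rw [frechet, Matrix.of_apply]
  refine Finset.sum_congr_of_eq_on_inter ?_ ?_ fun _ _ _ => rfl
  · intro k _ hk
    rw [hs k hk, h0, zero_mul]
  · intro k _ hk
    rw [pderiv_eq_zero_of_notMem hk, h0, zero_mul]

theorem frechet_miuraMap (β κ : 𝕜) :
    frechet (miuraMap (D 𝕜) β κ (fld 𝕜 0) (fld 𝕜 1)) = miuraOp (D 𝕜) β κ := by
  refine Matrix.ext fun i j => ?_
  rw [frechet_apply_eq_sum _ i j (Finset.range 2)]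
  · refine LinearMap.ext fun P => ?_
    fin_cases i <;> fin_cases j <;>
      simp [Finset.sum_range_succ, miuraMap, miuraOp, fld, MvPolynomial.pderiv_X, Pi.single_apply,
        mulOp]
    ring
  · intro k hk
    have h0 : k ≠ 0 := by rintro rfl; simp at hk
    have h1 : k ≠ 1 := by rintro rfl; simp at hk
    fin_cases i <;> fin_cases j <;>
      simp [miuraMap, fld, MvPolynomial.pderiv_X, h0.symm, h1.symm]

theorem isFormalAdjoint_miuraOp (β κ : 𝕜) :
    IsFormalAdjoint (miuraOp (D 𝕜) β κ) (miuraOpAdj (D 𝕜) β κ) := by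
  intro f g
  refine ⟨-(κ • (f 0 * g 1)), ?_⟩
  simp [act, Fin.sum_univ_two, miuraOp, miuraOpAdj, Algebra.smul_def]
  ring

theorem B₁_miuraMap (d : Derivation 𝕜 A A) (β κ : 𝕜) (m n : A) :
    B₁ d (miuraMap d β κ m n 0) (miuraMap d β κ m n 1) =
      miuraOp d β κ * E₁ d m n * miuraOpAdj d β κ := by
  refine Matrix.ext fun i j => LinearMap.ext fun x => ?_
  fin_cases i <;> fin_cases j <;>
    simp [B₁, miuraMap, miuraOp, E₁, miuraOpAdj, Matrix.mul_apply, Fin.sum_univ_two,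
      Algebra.smul_def] <;> ring

theorem B₂_eq_miuraOp (d : Derivation 𝕜 A A) {α β κ : 𝕜} (hκ : κ ≠ 0)
    (h : κ ^ 2 = 4 * (α + β ^ 2)) :
    B₂ d = miuraOp d β κ * E₂scaled d α β κ * miuraOpAdj d β κ := by
  have e4 : algebraMap 𝕜 A 4 = 4 := map_ofNat _ 4
  have e2 : algebraMap 𝕜 A 2 = 2 := map_ofNat _ 2
  obtain ⟨c, hc⟩ : ∃ c, c = (κ ^ 2)⁻¹ := ⟨_, rfl⟩
  have hcκ : c * κ ^ 2 = 1 := by rw [hc]; field_simp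
  have e₁ : algebraMap 𝕜 A c * algebraMap 𝕜 A κ ^ 2 = 1 := by
    rw [← map_pow, ← map_mul, hcκ, map_one]
  have e₂ : algebraMap 𝕜 A κ ^ 2 = 4 * (algebraMap 𝕜 A α + algebraMap 𝕜 A β ^ 2) := by
    rw [← map_pow, h]; simp [e4]
  refine Matrix.ext fun i j => LinearMap.ext fun x => ?_
  rw [E₂scaled, ← hc, Matrix.mul_smul, Matrix.smul_mul]
  fin_cases i <;> fin_cases j <;>
    simp [B₂, miuraOp, miuraOpAdj, pow_succ] <;>
    simp only [Algebra.smul_def, map_mul, e2, e4]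
  · linear_combination (d x - d (d (d x))) * e₁ - algebraMap 𝕜 A c * d x * e₂
  · ring
  · ring
  · linear_combination -d x * e₁

end Miura

end XDG

/-! ### Schwartz functions and functions of temperate growth -/

namespace XDG

section Rapid

/-- A smooth function is rapidly decreasing if it is a Schwartz function. -/
def Rapid (f : Smooth) : Prop := ∃ g : 𝓢(ℝ, ℝ), toSmooth g = f

/-- A smooth function of temperate growth. -/
def Temperate (f : Smooth) : Prop := Function.HasTemperateGrowth f.1

theorem toSmooth_add (f g : 𝓢(ℝ, ℝ)) : toSmooth (f + g) = toSmooth f + toSmooth g := rfl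

theorem toSmooth_smul (c : ℝ) (f : 𝓢(ℝ, ℝ)) : toSmooth (c • f) = c • toSmooth f := rfl

theorem rapid_toSmooth (f : 𝓢(ℝ, ℝ)) : Rapid (toSmooth f) := ⟨f, rfl⟩

variable {f g : Smooth}

namespace Rapid

theorem temperate (hf : Rapid f) : Temperate f := by
  obtain ⟨f, rfl⟩ := hf
  exact f.hasTemperateGrowth

theorem add (hf : Rapid f) (hg : Rapid g) : Rapid (f + g) := by
  obtain ⟨f, rfl⟩ := hf
  obtain ⟨g, rfl⟩ := hg
  exact ⟨f + g, rfl⟩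

theorem sub (hf : Rapid f) (hg : Rapid g) : Rapid (f - g) := by
  obtain ⟨f, rfl⟩ := hf
  obtain ⟨g, rfl⟩ := hg
  exact ⟨f - g, rfl⟩

theorem neg (hf : Rapid f) : Rapid (-f) := by
  obtain ⟨f, rfl⟩ := hf
  exact ⟨-f, rfl⟩

theorem smul (hf : Rapid f) (c : ℝ) : Rapid (c • f) := by
  obtain ⟨f, rfl⟩ := hf
  exact ⟨c • f, rfl⟩

theorem dx (hf : Rapid f) : Rapid (dx f) := by
  obtain ⟨f, rfl⟩ := hf
  exact ⟨SchwartzMap.derivCLM ℝ ℝ f, Subtype.ext <| funext fun x =>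
    SchwartzMap.derivCLM_apply ℝ f x⟩

theorem mul_temperate (hf : Rapid f) (hg : Temperate g) : Rapid (f * g) := by
  obtain ⟨f, rfl⟩ := hf
  refine ⟨SchwartzMap.smulLeftCLM ℝ g.1 f, Subtype.ext <| funext fun x => ?_⟩
  refine (SchwartzMap.smulLeftCLM_apply_apply hg f x).trans ?_
  exact mul_comm _ _

theorem temperate_mul (hf : Temperate f) (hg : Rapid g) : Rapid (f * g) :=
  mul_comm g f ▸ hg.mul_temperate hf

theorem mul (hf : Rapid f) (hg : Rapid g) : Rapid (f * g) := hf.mul_temperate hg.temperate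

theorem pow_succ (hf : Rapid f) (k : ℕ) : Rapid (f ^ (k + 1)) := by
  induction k with
  | zero => simpa
  | succ k ih => rw [_root_.pow_succ]; exact ih.mul hf

theorem ofNat_mul (hf : Rapid f) (k : ℕ) [k.AtLeastTwo] : Rapid (ofNat(k) * f) := by
  have := hf.smul (OfNat.ofNat k)
  rwa [Algebra.smul_def, map_ofNat] at this

theorem integrable (hf : Rapid f) : Integrable f.1 := by
  obtain ⟨f, rfl⟩ := hf
  exact f.integrable

theorem integral_add (hf : Rapid f) (hg : Rapid g) :
    ∫ x, (f + g).1 x = (∫ x, f.1 x) + ∫ x, g.1 x :=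
  MeasureTheory.integral_add hf.integrable hg.integrable

theorem integral_smul (f : Smooth) (c : ℝ) : ∫ x, (c • f).1 x = c * ∫ x, f.1 x :=
  integral_const_mul c f.1

/-- The integral over the line of a total derivative of a Schwartz function vanishes. -/
theorem integral_dx (hf : Rapid f) : ∫ x, (XDG.dx f).1 x = 0 :=
  integral_eq_zero_of_hasDerivAt_of_integrable
    (fun x => (Smooth.differentiableAt f x).hasDerivAt) hf.dx.integrable hf.integrable

end Rapid

namespace Temperate

theorem add (hf : Temperate f) (hg : Temperate g) : Temperate (f + g) :=
  Function.HasTemperateGrowth.add hf hg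

theorem neg (hf : Temperate f) : Temperate (-f) :=
  Function.HasTemperateGrowth.neg hf

theorem sub (hf : Temperate f) (hg : Temperate g) : Temperate (f - g) :=
  Function.HasTemperateGrowth.sub hf hg

theorem smul (hf : Temperate f) (c : ℝ) : Temperate (c • f) :=
  Function.HasTemperateGrowth.mul (Function.HasTemperateGrowth.const c) hf

theorem dx (hf : Temperate f) : Temperate (dx f) := by
  refine ⟨(XDG.dx f).2, fun n => ?_⟩
  obtain ⟨k, C, h⟩ := hf.2 (n + 1)
  refine ⟨k, C, fun x => ?_⟩
  have := h x
  rwa [norm_iteratedFDeriv_eq_norm_iteratedDeriv, iteratedDeriv_succ',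
    ← norm_iteratedFDeriv_eq_norm_iteratedDeriv] at this

/-- The fundamental lemma of the calculus of variations. -/
theorem eq_zero_of_integral_eq_zero (f : Smooth)
    (h : ∀ U : 𝓢(ℝ, ℝ), ∫ x, (f * toSmooth U).1 x = 0) : f = 0 := by
  have hc : Continuous f.1 := (Smooth.contDiff f).continuous
  have h0 : f.1 =ᵐ[volume] 0 := by
    refine ae_eq_zero_of_integral_contDiff_smul_eq_zero hc.locallyIntegrable fun u hu hs => ?_
    have := h (hs.toSchwartzMap hu)
    rw [← this]
    refine integral_congr_ae (Filter.Eventually.of_forall fun x => ?_)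
    exact mul_comm _ _
  refine Subtype.ext ?_
  exact Continuous.ae_eq_iff_eq volume hc continuous_zero |>.1 h0

end Temperate

end Rapid

end XDG

/-! ### The equation `G'' = c G - F` -/

namespace XDG

section LinearODE

/-- A function of at most polynomial growth. -/
def PolyBdd {E : Type*} [NormedAddCommGroup E] (f : ℝ → E) : Prop :=
  ∃ (C : ℝ) (k : ℕ), ∀ x, ‖f x‖ ≤ C * (1 + |x|) ^ k

namespace PolyBdd

theorem of_le {f : ℝ → ℝ} {E : Type*} [NormedAddCommGroup E] {g : ℝ → E} (hg : PolyBdd g)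
    (h : ∀ x, ‖f x‖ ≤ ‖g x‖) : PolyBdd f := by
  obtain ⟨C, k, hg⟩ := hg
  exact ⟨C, k, fun x => (h x).trans (hg x)⟩

theorem add {E : Type*} [NormedAddCommGroup E] {f g : ℝ → E} (hf : PolyBdd f) (hg : PolyBdd g) :
    PolyBdd (fun x => f x + g x) := by
  obtain ⟨C, k, hf⟩ := hf
  obtain ⟨C', k', hg⟩ := hg
  refine ⟨|C| + |C'|, max k k', fun x => ?_⟩
  have e (C : ℝ) {k l : ℕ} (h : k ≤ l) : C * (1 + |x|) ^ k ≤ |C| * (1 + |x|) ^ l := by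
    gcongr
    · exact le_abs_self C
    · simp
  rw [add_mul]
  exact (norm_add_le _ _).trans (add_le_add ((hf x).trans (e C (le_max_left _ _)))
    ((hg x).trans (e C' (le_max_right _ _))))

theorem const_mul {E : Type*} [NormedRing E] {f : ℝ → E} (hf : PolyBdd f) (a : E) :
    PolyBdd (fun x => a * f x) := by
  obtain ⟨C, k, hf⟩ := hf
  refine ⟨‖a‖ * C, k, fun x => (norm_mul_le _ _).trans ?_⟩
  rw [mul_assoc]
  gcongr
  exact hf x

end PolyBdd

theorem Temperate.polyBdd {f : Smooth} (hf : Temperate f) : PolyBdd f.1 := by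
  obtain ⟨k, C, h⟩ := hf.2 0
  exact ⟨C, k, fun x => by simpa using h x⟩

theorem iteratedDeriv_eq_dx_iterate (f : Smooth) (n : ℕ) :
    iteratedDeriv n f.1 = (dx^[n] f).1 := by
  induction n with
  | zero => simp
  | succ n ih =>
    rw [iteratedDeriv_succ, ih, Function.iterate_succ_apply']
    rfl

/-- A smooth solution of `G'' = c G - F` is of temperate growth once `F` is and `G`, `G'` are
polynomially bounded, since all further derivatives are expressed through these. -/
theorem temperate_of_ode {F G : Smooth} {c : ℝ} (hF : Temperate F) (h : dx (dx G) = c • G - F)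
    (h₀ : PolyBdd G.1) (h₁ : PolyBdd (dx G).1) : Temperate G := by
  have key (n : ℕ) : PolyBdd (dx^[n] G).1 ∧ PolyBdd (dx^[n + 1] G).1 := by
    induction n with
    | zero => exact ⟨h₀, h₁⟩
    | succ n ih =>
      refine ⟨ih.2, ?_⟩
      have hn (n : ℕ) : dx^[n] (c • G - F) = c • dx^[n] G - dx^[n] F := by
        induction n with
        | zero => rfl
        | succ n ih => simp only [Function.iterate_succ_apply', ih, map_sub, dx.map_smul]
      have hFn (n : ℕ) : Temperate (dx^[n] F) := by
        induction n with
        | zero => exact hF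
        | succ n ih => rw [Function.iterate_succ_apply']; exact ih.dx
      rw [Function.iterate_succ_apply, Function.iterate_succ_apply, h, hn, sub_eq_add_neg]
      exact (ih.1.const_mul c).add (hFn n).neg.polyBdd
  refine ⟨G.2, fun n => ?_⟩
  obtain ⟨C, k, hk⟩ := (key n).1
  refine ⟨k, C, fun x => ?_⟩
  rw [norm_iteratedFDeriv_eq_norm_iteratedDeriv, iteratedDeriv_eq_dx_iterate]
  exact hk x

/-- A polynomially bounded solution of the first order system `G' = z`, `z' = c G - F` gives a
solution of temperate growth of the second order equation. -/
theorem exists_temperate_of_system {F : Smooth} (hF : Temperate F) {c : ℝ} {G z : ℝ → ℝ}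
    (hG : ∀ x, HasDerivAt G (z x) x) (hz : ∀ x, HasDerivAt z (c * G x - F.1 x) x)
    (hGb : PolyBdd G) (hzb : PolyBdd z) :
    ∃ G : Smooth, Temperate G ∧ dx (dx G) = c • G - F := by
  have dG : deriv G = z := funext fun x => (hG x).deriv
  have dz : deriv z = fun x => c * G x - F.1 x := funext fun x => (hz x).deriv
  have hs : ∀ n : ℕ, ContDiff ℝ n G ∧ ContDiff ℝ n z := by
    intro n
    induction n with
    | zero =>
      exact ⟨contDiff_zero.2 (continuous_iff_continuousAt.2 fun x => (hG x).continuousAt),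
        contDiff_zero.2 (continuous_iff_continuousAt.2 fun x => (hz x).continuousAt)⟩
    | succ n ih =>
      constructor
      · push_cast
        refine contDiff_succ_iff_deriv.2 ⟨fun x => (hG x).differentiableAt, by simp, ?_⟩
        rw [dG]
        exact ih.2
      · push_cast
        refine contDiff_succ_iff_deriv.2 ⟨fun x => (hz x).differentiableAt, by simp, ?_⟩
        rw [dz]
        exact (contDiff_const.mul ih.1).sub
          ((Smooth.contDiff F).of_le (mod_cast le_top))
  have hsm : ContDiff ℝ ∞ G := contDiff_infty.2 fun n => (hs n).1
  have h : dx (dx ⟨G, hsm⟩) = c • (⟨G, hsm⟩ : Smooth) - F := by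
    refine Subtype.ext ?_
    change deriv (deriv G) = _
    rw [dG, dz]
    rfl
  refine ⟨⟨G, hsm⟩, temperate_of_ode hF h hGb ?_, h⟩
  change PolyBdd (deriv G)
  rwa [dG]

/-- The bounded solution of `y' + k y = f` for `k > 0` and bounded `f`. -/
theorem exists_bounded_of_pos {k : ℝ} (hk : 0 < k) {f : ℝ → ℝ} (hf : Continuous f) {C : ℝ}
    (hC : ∀ x, ‖f x‖ ≤ C) :
    ∃ y : ℝ → ℝ, (∀ x, HasDerivAt y (f x - k * y x) x) ∧ ∀ x, ‖y x‖ ≤ C / k := by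
  set g : ℝ → ℝ := fun t => Real.exp (k * t) * f t
  have hg : Continuous g := by fun_prop
  have hle (x : ℝ) : ‖g x‖ ≤ C * Real.exp (k * x) := by
    rw [norm_mul, Real.norm_of_nonneg (Real.exp_pos _).le, mul_comm]
    gcongr
    exact hC x
  have hint (x : ℝ) : IntegrableOn g (Set.Iic x) :=
    ((integrableOn_exp_mul_Iic hk x).const_mul C).mono' hg.aestronglyMeasurable
      (Filter.Eventually.of_forall hle)
  refine ⟨fun x => Real.exp (-(k * x)) * ∫ t in Set.Iic x, g t, fun x => ?_, fun x => ?_⟩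
  · have h₁ : HasDerivAt (fun x => ∫ t in Set.Iic x, g t) (g x) x := by
      have h := (hg.integral_hasStrictDerivAt 0 x).hasDerivAt.add_const (∫ t in Set.Iic 0, g t)
      refine h.congr_of_eventuallyEq (Filter.Eventually.of_forall fun y => ?_)
      change _ = (∫ t in (0 : ℝ)..y, g t) + ∫ t in Set.Iic 0, g t
      rw [← intervalIntegral.integral_Iic_sub_Iic (hint 0) (hint y)]
      ring
    have h₂ : HasDerivAt (fun x => Real.exp (-(k * x))) (Real.exp (-(k * x)) * -(k * 1)) x :=
      (((hasDerivAt_id x).const_mul k).neg).exp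
    refine (h₂.mul h₁).congr_deriv ?_
    have h₃ : Real.exp (-(k * x)) * Real.exp (k * x) = 1 := by rw [← Real.exp_add]; simp
    simp only [g]
    linear_combination f x * h₃
  · have h₁ : ‖∫ t in Set.Iic x, g t‖ ≤ ∫ t in Set.Iic x, C * Real.exp (k * t) :=
      norm_integral_le_of_norm_le ((integrableOn_exp_mul_Iic hk x).const_mul C)
        (Filter.Eventually.of_forall hle)
    rw [integral_const_mul, integral_exp_mul_Iic hk] at h₁
    have h₃ : Real.exp (-(k * x)) * Real.exp (k * x) = 1 := by rw [← Real.exp_add]; simp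
    rw [norm_mul, Real.norm_of_nonneg (Real.exp_pos _).le]
    calc _ ≤ Real.exp (-(k * x)) * (C * (Real.exp (k * x) / k)) := by gcongr
      _ = C / k := by rw [← one_mul (C / k), ← h₃]; ring

/-- For purely imaginary `k`, including `k = 0`, the equation `y' + k y = f` with polynomially bounded
`f` has a polynomially bounded solution. -/
theorem exists_polyBdd_of_re_eq_zero {k : ℂ} (hk : k.re = 0) {f : ℝ → ℂ} (hf : Continuous f)
    (hfb : PolyBdd f) :
    ∃ y : ℝ → ℂ, (∀ x, HasDerivAt y (f x - k * y x) x) ∧ PolyBdd y := by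
  have hn (a : ℂ) (ha : a.re = 0) (x : ℝ) : ‖Complex.exp (a * x)‖ = 1 := by
    simp [Complex.norm_exp, ha]
  set g : ℝ → ℂ := fun t => Complex.exp (k * t) * f t
  have hg : Continuous g := by fun_prop
  refine ⟨fun x => Complex.exp (-k * x) * ∫ t in (0 : ℝ)..x, g t, fun x => ?_, ?_⟩
  · have h₁ := (hg.integral_hasStrictDerivAt 0 x).hasDerivAt
    have h₂ : HasDerivAt (fun x : ℝ => Complex.exp (-k * x)) (Complex.exp (-k * x) * (-k * 1)) x :=
      ((Complex.ofRealCLM.hasDerivAt (x := x)).const_mul (-k)).cexp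
    refine (h₂.mul h₁).congr_deriv ?_
    have h₃ : Complex.exp (-k * x) * Complex.exp (k * x) = 1 := by rw [← Complex.exp_add]; simp
    simp only [g]
    linear_combination f x * h₃
  · obtain ⟨C, N, hC⟩ := hfb
    have hC0 : 0 ≤ C := by simpa using (norm_nonneg _).trans (hC 0)
    refine ⟨C, N + 1, fun x => ?_⟩
    rw [norm_mul, hn _ (by simp [hk]), one_mul]
    refine (intervalIntegral.norm_integral_le_of_norm_le_const
      (C := C * (1 + |x|) ^ N) fun t ht => ?_).trans ?_
    · rw [norm_mul, hn _ hk, one_mul]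
      refine (hC t).trans ?_
      have : |t| ≤ |x| := by
        have := Set.abs_sub_left_of_mem_uIcc (Set.uIoc_subset_uIcc ht)
        simpa using this
      gcongr
    · rw [sub_zero, pow_succ, ← mul_assoc]
      gcongr
      simp

/-- For every real `c` and every Schwartz function `F`, the equation `G'' = c G - F` has a solution
of temperate growth. -/
theorem exists_temperate_ode (c : ℝ) {F : Smooth} (hF : Rapid F) :
    ∃ G : Smooth, Temperate G ∧ dx (dx G) = c • G - F := by
  have hFc : Continuous F.1 := (Smooth.contDiff F).continuous
  rcases lt_or_ge 0 c with hc | hc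
  · -- `∂² - c = (∂ + k)(∂ - k)`; the factor `∂ - k` is inverted by reflection.
    set k := √c
    have hk : 0 < k := Real.sqrt_pos.2 hc
    have hk2 : k * k = c := Real.mul_self_sqrt hc.le
    obtain ⟨C, hC⟩ : ∃ C, ∀ x, ‖F.1 x‖ ≤ C := by
      obtain ⟨f, rfl⟩ := hF
      exact ⟨_, f.norm_le_seminorm ℝ⟩
    obtain ⟨y, hy, hyb⟩ := exists_bounded_of_pos hk (f := fun x => -F.1 x) hFc.neg
      (C := C) (by simpa using hC)
    have hyc : Continuous y := continuous_iff_continuousAt.2 fun x => (hy x).continuousAt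
    obtain ⟨w, hw, hwb⟩ := exists_bounded_of_pos hk (f := fun x => y (-x))
      (hyc.comp continuous_neg) (fun x => hyb (-x))
    have hG (x : ℝ) : HasDerivAt (fun x => -w (-x)) (y x + k * (-w (-x))) x := by
      refine ((hw (-x)).comp x (hasDerivAt_neg x)).neg.congr_deriv ?_
      simp only [neg_neg]
      ring
    have bG : PolyBdd (fun x => -w (-x)) := ⟨C / k / k, 0, fun x => by simpa using hwb (-x)⟩
    have by' : PolyBdd y := ⟨C / k, 0, fun x => by simpa using hyb x⟩
    refine exists_temperate_of_system hF.temperate hG (fun x => ?_) bG (by'.add (bG.const_mul k))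
    refine ((hy x).add ((hG x).const_mul k)).congr_deriv ?_
    rw [← hk2]
    ring
  · -- The same factorisation with `k` imaginary; the real part of the complex solution is taken.
    set k : ℂ := √(-c) * Complex.I
    have hk2 : k * k = c := by
      have : (√(-c) : ℂ) * √(-c) = -c := by
        rw [← Complex.ofReal_mul, Real.mul_self_sqrt (by linarith)]; simp
      linear_combination Complex.I * Complex.I * this - c * Complex.I_mul_I
    have hk : k.re = 0 := by simp [k]
    obtain ⟨y, hy, hyb⟩ := exists_polyBdd_of_re_eq_zero hk
      (f := fun x => ((-F.1 x : ℝ) : ℂ)) (by fun_prop) (by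
        obtain ⟨C, N, h⟩ := hF.temperate.polyBdd
        exact ⟨C, N, fun x => by simpa using h x⟩)
    have hyc : Continuous y := continuous_iff_continuousAt.2 fun x => (hy x).continuousAt
    obtain ⟨w, hw, hwb⟩ := exists_polyBdd_of_re_eq_zero (k := -k) (by simp [hk]) hyc hyb
    have hre {f : ℝ → ℂ} {f' : ℂ} {x : ℝ} (h : HasDerivAt f f' x) :
        HasDerivAt (fun x => (f x).re) f'.re x := Complex.reCLM.hasFDerivAt.comp_hasDerivAt x h
    refine exists_temperate_of_system hF.temperate (G := fun x => (w x).re)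
      (z := fun x => (y x + k * w x).re) (fun x => ?_) (fun x => ?_)
      (hwb.of_le fun x => Complex.abs_re_le_norm _)
      ((hyb.add (hwb.const_mul k)).of_le fun x => Complex.abs_re_le_norm _)
    · refine (hre (hw x)).congr_deriv ?_
      congr 1
      ring
    · refine (hre ((hy x).add ((hw x).const_mul k))).congr_deriv ?_
      have : ((-F.1 x : ℝ) : ℂ) - k * y x + k * (y x - -k * w x) =
          ((c : ℝ) : ℂ) * w x - (F.1 x : ℝ) := by
        push_cast
        linear_combination w x * hk2
      rw [this]
      simp

/-- Nonzero exponentials are not polynomially bounded. -/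
theorem eq_zero_of_deriv_eq_mul {z : ℝ → ℝ} {a : ℝ} (ha : a ≠ 0)
    (hz : ∀ x, HasDerivAt z (a * z x) x) (hb : PolyBdd z) (x : ℝ) : z x = 0 := by
  have hconst (x : ℝ) : z x = z 0 * Real.exp (a * x) := by
    have h (x : ℝ) : HasDerivAt (fun x => z x * Real.exp (-(a * x))) 0 x := by
      have h₂ : HasDerivAt (fun x => Real.exp (-(a * x))) (Real.exp (-(a * x)) * -(a * 1)) x :=
        (((hasDerivAt_id x).const_mul a).neg).exp
      exact ((hz x).mul h₂).congr_deriv (by ring)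
    have := is_const_of_deriv_eq_zero (fun x => (h x).differentiableAt) (fun x => (h x).deriv) x 0
    simp only [mul_zero, neg_zero, Real.exp_zero, mul_one] at this
    rw [← this, mul_assoc, ← Real.exp_add]
    simp
  obtain ⟨C, N, hC⟩ := hb
  have hb : 0 < |a| := abs_pos.2 ha
  -- Compare at the points with `a t = s - |a|`, `s → ∞`, where `1 + |t| = s / |a|`.
  have hle : ∀ᶠ s : ℝ in Filter.atTop,
      |z 0| ≤ C * Real.exp |a| * (|a|⁻¹) ^ N * (s ^ N * Real.exp (-s)) := by
    filter_upwards [Filter.eventually_ge_atTop |a|] with s hs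
    have h₀ : 0 ≤ s / |a| - 1 := by rw [sub_nonneg, one_le_div hb]; exact hs
    have h := hC ((s / |a| - 1) * SignType.sign a)
    have e₁ : |(s / |a| - 1) * (SignType.sign a : ℝ)| = s / |a| - 1 := by
      rw [abs_mul, abs_of_nonneg h₀]
      rcases ha.lt_or_gt with h | h <;> simp [h]
    have e₂ : a * ((s / |a| - 1) * SignType.sign a) = s - |a| := by
      rw [mul_left_comm, mul_comm a, sign_mul_self]
      field_simp
    rw [hconst, e₁, e₂, norm_mul, Real.norm_of_nonneg (Real.exp_pos _).le, Real.norm_eq_abs,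
      add_sub_cancel] at h
    calc |z 0| = |z 0| * Real.exp (s - |a|) * Real.exp (|a| - s) := by
          rw [mul_assoc, ← Real.exp_add]; simp
      _ ≤ C * (s / |a|) ^ N * Real.exp (|a| - s) := by gcongr
      _ = _ := by rw [sub_eq_add_neg, Real.exp_add, div_eq_mul_inv, mul_pow]; ring
  have hlim := (Real.tendsto_pow_mul_exp_neg_atTop_nhds_zero N).const_mul
    (C * Real.exp |a| * (|a|⁻¹) ^ N)
  have h0 : |z 0| ≤ 0 := by simpa using ge_of_tendsto hlim hle
  rw [hconst, abs_nonpos_iff.1 h0, zero_mul]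

/-- For `c > 0` the equation `G'' = c G` has no nonzero solution of temperate growth. -/
theorem eq_zero_of_temperate_of_ode {G : Smooth} (hG : Temperate G) {c : ℝ} (hc : 0 < c)
    (h : dx (dx G) = c • G) : G = 0 := by
  set k := √c
  have hk : 0 < k := Real.sqrt_pos.2 hc
  have hk2 : k * k = c := Real.mul_self_sqrt hc.le
  have hd (f : Smooth) (x : ℝ) : HasDerivAt f.1 ((dx f).1 x) x :=
    (Smooth.differentiableAt f x).hasDerivAt
  have h₁ : dx G - k • G = 0 := by
    refine Subtype.ext <| funext fun x =>
      eq_zero_of_deriv_eq_mul (neg_ne_zero.2 hk.ne') (fun x => ?_) (hG.dx.sub (hG.smul k)).polyBdd x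
    refine (hd _ x).congr_deriv ?_
    rw [map_sub, dx.map_smul, h]
    change c * G.1 x - k * (dx G).1 x = -k * ((dx G).1 x - k * G.1 x)
    rw [← hk2]
    ring
  refine Subtype.ext <| funext fun x =>
    eq_zero_of_deriv_eq_mul hk.ne' (fun x => ?_) hG.polyBdd x
  refine (hd _ x).congr_deriv ?_
  rw [sub_eq_zero.1 h₁]
  rfl

end LinearODE

end XDG

/-! ### Densities and gradients in a differential algebra -/

namespace XDG

section Gradients

variable {𝕜 A : Type*} [Field 𝕜] [CommRing A] [Algebra 𝕜 A]

theorem derivation_ofNat (d : Derivation 𝕜 A A) (k : ℕ) [k.AtLeastTwo] : d ofNat(k) = 0 := by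
  rw [← Nat.cast_ofNat (R := A)]
  exact d.map_natCast _

/-- The potential `w = vₓ + 2βv - u`, through which both XDG densities are expressed. -/
def xdgPot (d : Derivation 𝕜 A A) (β : 𝕜) (u v : A) : A := d v + (2 * β) • v - u

theorem xdgFields_zero_eq (d : Derivation 𝕜 A A) (α β : 𝕜) (u v : A) :
    xdgFields d α β u v 0 =
      (4 * (α + β ^ 2)) • xdgPot d β u v - d (d (xdgPot d β u v))
        - d (xdgFields d α β u v 1) - (2 * β) • xdgFields d α β u v 1 := by
  simp [xdgFields, xdgPot, Algebra.smul_def]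
  ring

theorem h₁_eq (d : Derivation 𝕜 A A) (α β : 𝕜) (u v : A) :
    h₁ d α β u v = xdgPot d β u v *
      ((4 * (α + β ^ 2)) • xdgPot d β u v - d (d (xdgPot d β u v)))
        - xdgFields d α β u v 1 ^ 2 := by
  have h := xdgFields_zero_eq d α β u v
  have h' : h₁ d α β u v = xdgPot d β u v * (d (xdgFields d α β u v 1) +
    (2 * β) • xdgFields d α β u v 1 + xdgFields d α β u v 0) - xdgFields d α β u v 1 ^ 2 := rfl
  rw [h', h]
  ring

theorem h₂_eq (d : Derivation 𝕜 A A) (α β : 𝕜) (u v : A) :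
    h₂ d α β u v = -(xdgPot d β u v * (d (xdgPot d β u v) ^ 2
      + (4 * (α + β ^ 2)) • xdgPot d β u v ^ 2 - xdgFields d α β u v 1 ^ 2)) := by
  have e : d (xdgPot d β u v) = d (d v) + (2 * β) • d v - d u := by
    simp [xdgPot]
  rw [e, h₂, xdgPot]
  ring

theorem xdgPot_add_smul (d : Derivation 𝕜 A A) (β ε : 𝕜) (u v U V : A) :
    xdgPot d β (u + ε • U) (v + ε • V) = xdgPot d β u v + ε • xdgPot d β U V := by
  simp only [xdgPot, map_add, d.map_smul]
  module

theorem xdgFields_one_add_smul (d : Derivation 𝕜 A A) (α β ε : 𝕜) (u v U V : A) :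
    xdgFields d α β (u + ε • U) (v + ε • V) 1 =
      xdgFields d α β u v 1 + ε • xdgFields d α β U V 1 := by
  simp only [xdgFields, Matrix.cons_val_one, Matrix.cons_val_fin_one, map_add, d.map_smul]
  module

/-- The variational gradient `(4w, -4wₓ + 8βw - 4n)` of `H₁`. -/
def xdgGrad₁ (d : Derivation 𝕜 A A) (α β : 𝕜) (u v : A) : Fin 2 → A :=
  let w := xdgPot d β u v
  let n := xdgFields d α β u v 1
  ![4 * w, 8 * β • w - 4 * d w - 4 * n]

/-- The function `F = wₓ² + 2wwₓₓ - 4(α + β²)·3w² + n²`, half the derivative of `H₂` with respect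
to `w`; a solution `G` of `4(α + β²)G - Gₓₓ = F` enters the gradient of `H₂`. -/
def xdgSource (d : Derivation 𝕜 A A) (α β : 𝕜) (u v : A) : A :=
  let w := xdgPot d β u v
  let n := xdgFields d α β u v 1
  d w ^ 2 + 2 * (w * d (d w)) - (4 * (α + β ^ 2)) • (3 * w ^ 2) + n ^ 2

/-- The variational gradient `(2G, -2Gₓ + 4βG + 4wn)` of `H₂`. -/
def xdgGrad₂ (d : Derivation 𝕜 A A) (α β : 𝕜) (u v G : A) : Fin 2 → A :=
  ![2 * G, 4 * β • G - 2 * d G + 4 * (xdgPot d β u v * xdgFields d α β u v 1)]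

theorem act_E₁_xdgGrad₁ (d : Derivation 𝕜 A A) (α β : 𝕜) (u v : A) :
    act (E₁ d (xdgFields d α β u v 0) (xdgFields d α β u v 1)) (xdgGrad₁ d α β u v) =
      xdgRHS d α β u v := by
  have e4 : algebraMap 𝕜 A 4 = 4 := map_ofNat _ 4
  have e2 : algebraMap 𝕜 A 2 = 2 := map_ofNat _ 2
  ext i
  fin_cases i
  · simp only [Fin.zero_eta, act_E₁_zero]
    simp [xdgGrad₁, xdgRHS, xdgFields, xdgPot, Algebra.smul_def, derivation_ofNat, e4, e2]
    ring
  · simp only [Fin.mk_one, act_E₁_one]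
    simp [xdgGrad₁, xdgRHS, xdgFields, xdgPot, Algebra.smul_def, derivation_ofNat, e4, e2]
    ring

theorem act_E₂_xdgGrad₂ (d : Derivation 𝕜 A A) (α β : 𝕜) (u v G : A)
    (hG : d (d G) = (4 * (α + β ^ 2)) • G - xdgSource d α β u v) :
    act (E₂ d α β) (xdgGrad₂ d α β u v G) = xdgRHS d α β u v := by
  have e4 : algebraMap 𝕜 A 4 = 4 := map_ofNat _ 4
  have e2 : algebraMap 𝕜 A 2 = 2 := map_ofNat _ 2
  have hG' := congr(d $hG)
  have hm := xdgFields_zero_eq d α β u v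
  have hr : xdgRHS d α β u v =
      ![4 * (d (xdgFields d α β u v 0 * xdgPot d β u v)
          + xdgFields d α β u v 0 * d (xdgPot d β u v))
        + 4 * xdgFields d α β u v 1 * d ((2 * β) • xdgPot d β u v - d (xdgPot d β u v)
          - xdgFields d α β u v 1), 4 * d (xdgFields d α β u v 1 * xdgPot d β u v)] := by
    have : d u - (2 * β) • u - (4 * α) • v = (2 * β) • xdgPot d β u v - d (xdgPot d β u v)
          - xdgFields d α β u v 1 := by
      simp [xdgFields, xdgPot, Algebra.smul_def, derivation_ofNat, e4, e2]
      ring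
    rw [← this]
    rfl
  rw [hr, hm]
  simp only [xdgSource, xdgGrad₂] at hG' ⊢
  generalize xdgFields d α β u v 1 = n at *
  generalize xdgPot d β u v = w at *
  ext i
  fin_cases i
  · simp [Algebra.smul_def, derivation_ofNat, e4, e2, act, E₂, pow_succ] at hG' ⊢
    linear_combination 2 * hG'
  · simp [Algebra.smul_def, derivation_ofNat, e4, e2, act, E₂, pow_succ] at hG' ⊢
    ring

/-- The source `3q² - qₓ² - 2qqₓₓ - ρ²`, the derivative of `q (q² + qₓ² - ρ²)` with respect
to `q`. -/
def chSource (d : Derivation 𝕜 A A) (q ρ : A) : A :=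
  3 * q ^ 2 - d q ^ 2 - 2 * (q * d (d q)) - ρ ^ 2

theorem act_B₁_chGrad (d : Derivation 𝕜 A A) (q ρ : A) :
    act (B₁ d (chFields d q ρ 0) (chFields d q ρ 1)) ![q, -ρ] = chRHS d q ρ := by
  ext i
  fin_cases i <;> simp [act, B₁, chFields, chRHS]; ring

theorem act_B₂_chGrad [CharZero 𝕜] (d : Derivation 𝕜 A A) (q ρ G : A)
    (hG : d (d G) = (1 : 𝕜) • G - (1 / 2 : 𝕜) • chSource d q ρ) :
    act (B₂ d) ![G, -(q * ρ)] = chRHS d q ρ := by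
  have hG' := congr(d $hG)
  have e : 2 * algebraMap 𝕜 A 2⁻¹ = 1 := by
    rw [← map_ofNat (algebraMap 𝕜 A) 2, ← map_mul]; simp
  ext i
  fin_cases i
  · simp [act, B₂, chFields, chRHS, chSource, derivation_ofNat, Algebra.smul_def, pow_succ]
      at hG' ⊢
    linear_combination hG' + (2 * d q * d (d q) + q * d (d (d q)) + ρ * d ρ - 3 * q * d q) * e
  · simp [act, B₂, chFields, chRHS]
    ring

end Gradients

section Variation

/-- A functional `s ∫ h dx` whose density is cubic along each variation, with linear part equal to
`g · δΛ` up to a total derivative of a Schwartz function, has the variational gradient `g`. -/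
theorem isVarGradient_of_expansion (Λ : Smooth → Smooth → Fin 2 → Smooth)
    (h : Smooth → Smooth → Smooth) (s : ℝ) (u v : 𝓢(ℝ, ℝ)) (g : Fin 2 → Smooth)
    (hg : ∀ i, Temperate (g i))
    (hexp : ∀ U V : 𝓢(ℝ, ℝ), ∃ a₀ a₁ a₂ a₃ b : Smooth,
      Rapid a₀ ∧ Rapid a₁ ∧ Rapid a₂ ∧ Rapid a₃ ∧ Rapid b ∧
      (∀ ε : ℝ, h (toSmooth u + ε • toSmooth U) (toSmooth v + ε • toSmooth V) =
        a₀ + ε • a₁ + ε ^ 2 • a₂ + ε ^ 3 • a₃) ∧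
      s • a₁ - (g 0 * Λ (toSmooth U) (toSmooth V) 0 + g 1 * Λ (toSmooth U) (toSmooth V) 1)
        = dx b) :
    IsVarGradient Λ (fun u v => s * ∫ x, (h (toSmooth u) (toSmooth v)).1 x) u v g := by
  refine ⟨hg, fun U V => ?_⟩
  obtain ⟨a₀, a₁, a₂, a₃, b, h₀, h₁, h₂, h₃, hb, he, hd⟩ := hexp U V
  have hI : (∫ x, ∑ i, (g i).1 x * (Λ (toSmooth U) (toSmooth V) i).1 x) =
      s * ∫ x, a₁.1 x := by
    have e (x : ℝ) : ∑ i, (g i).1 x * (Λ (toSmooth U) (toSmooth V) i).1 x =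
        s * a₁.1 x - (dx b).1 x := by
      rw [← hd, Fin.sum_univ_two]
      change _ = s * a₁.1 x - (s * a₁.1 x - ((g 0).1 x * (Λ (toSmooth U) (toSmooth V) 0).1 x +
        (g 1).1 x * (Λ (toSmooth U) (toSmooth V) 1).1 x))
      ring
    simp_rw [e]
    rw [integral_sub (h₁.integrable.const_mul s) hb.dx.integrable, hb.integral_dx,
      integral_const_mul, sub_zero]
  have hF (ε : ℝ) : s * ∫ x, (h (toSmooth (u + ε • U)) (toSmooth (v + ε • V))).1 x =
      s * ((∫ x, a₀.1 x) + ε * (∫ x, a₁.1 x) + ε ^ 2 * (∫ x, a₂.1 x)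
        + ε ^ 3 * ∫ x, a₃.1 x) := by
    rw [toSmooth_add, toSmooth_add, toSmooth_smul, toSmooth_smul, he]
    rw [Rapid.integral_add ((h₀.add (h₁.smul ε)).add (h₂.smul _)) (h₃.smul _),
      Rapid.integral_add (h₀.add (h₁.smul ε)) (h₂.smul _),
      Rapid.integral_add h₀ (h₁.smul ε), Rapid.integral_smul, Rapid.integral_smul,
      Rapid.integral_smul]
  simp_rw [hF, hI]
  have p₁ := (hasDerivAt_id (0 : ℝ)).mul_const (∫ x, a₁.1 x)
  have p₂ := (hasDerivAt_pow 2 (0 : ℝ)).mul_const (∫ x, a₂.1 x)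
  have p₃ := (hasDerivAt_pow 3 (0 : ℝ)).mul_const (∫ x, a₃.1 x)
  refine ((((p₁.const_add (∫ x, a₀.1 x)).add p₂).add p₃).const_mul s).congr_deriv ?_
  norm_num

/-- Two variational gradients of the same functional pair equally with every variation. -/
theorem IsVarGradient.integral_sub_eq_zero {Λ : Smooth → Smooth → Fin 2 → Smooth}
    {H : 𝓢(ℝ, ℝ) → 𝓢(ℝ, ℝ) → ℝ} {u v : 𝓢(ℝ, ℝ)} {g g' : Fin 2 → Smooth}
    (hΛ : ∀ (U V : 𝓢(ℝ, ℝ)) i, Rapid (Λ (toSmooth U) (toSmooth V) i))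
    (h : IsVarGradient Λ H u v g) (h' : IsVarGradient Λ H u v g') (U V : 𝓢(ℝ, ℝ)) :
    ∫ x, ((g 0 - g' 0) * Λ (toSmooth U) (toSmooth V) 0 +
      (g 1 - g' 1) * Λ (toSmooth U) (toSmooth V) 1).1 x = 0 := by
  have e := (h.2 U V).unique (h'.2 U V)
  have hi {g : Fin 2 → Smooth} (hg : ∀ i, Temperate (g i)) :
      Integrable fun x => ∑ i, (g i).1 x * (Λ (toSmooth U) (toSmooth V) i).1 x :=
    integrable_finsetSum _ fun i _ => (Rapid.temperate_mul (hg i) (hΛ U V i)).integrable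
  rw [← sub_eq_zero, ← integral_sub (hi h.1) (hi h'.1)] at e
  rw [← e]
  refine integral_congr_ae (Filter.Eventually.of_forall fun x => ?_)
  simp only [Fin.sum_univ_two]
  change ((g 0).1 x - (g' 0).1 x) * _ + ((g 1).1 x - (g' 1).1 x) * _ = _
  ring

/-- For `c > 0` the range of `∂² - c` on Schwartz functions separates functions of temperate
growth. -/
theorem eq_zero_of_integral_mul_ode_eq_zero {δ : Smooth} (hδ : Temperate δ) {c : ℝ} (hc : 0 < c)
    (h : ∀ U : 𝓢(ℝ, ℝ),
      ∫ x, (δ * (dx (dx (toSmooth U)) - c • toSmooth U)).1 x = 0) : δ = 0 := by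
  refine eq_zero_of_temperate_of_ode hδ hc (sub_eq_zero.1 ?_)
  refine Temperate.eq_zero_of_integral_eq_zero _ fun U => ?_
  have hU := rapid_toSmooth U
  have hb : Rapid (δ * dx (toSmooth U) - dx δ * toSmooth U) :=
    (Rapid.temperate_mul hδ hU.dx).sub (Rapid.temperate_mul hδ.dx hU)
  have e : (dx (dx δ) - c • δ) * toSmooth U =
      δ * (dx (dx (toSmooth U)) - c • toSmooth U) -
        dx (δ * dx (toSmooth U) - dx δ * toSmooth U) := by
    simp only [map_sub, Derivation.leibniz, smul_eq_mul, Algebra.smul_def]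
    ring
  rw [e]
  have := integral_sub (Rapid.temperate_mul hδ (hU.dx.dx.sub (hU.smul c))).integrable
    hb.dx.integrable
  refine this.trans ?_
  rw [h, hb.integral_dx, sub_zero]

theorem toSmooth_zero : toSmooth 0 = 0 := rfl

end Variation

end XDG

/-! ### Gradients on Schwartz functions and Hamiltonian flows -/

namespace XDG

section SchwartzFields

theorem rapid_xdgPot (β : ℝ) (u v : 𝓢(ℝ, ℝ)) : Rapid (xdgPot dx β (toSmooth u) (toSmooth v)) :=
  ((rapid_toSmooth v).dx.add ((rapid_toSmooth v).smul _)).sub (rapid_toSmooth u)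

theorem rapid_xdgFields (α β : ℝ) (u v : 𝓢(ℝ, ℝ)) (i : Fin 2) :
    Rapid (xdgFields dx α β (toSmooth u) (toSmooth v) i) := by
  have hu := rapid_toSmooth u
  have hv := rapid_toSmooth v
  fin_cases i
  · exact hu.dx.dx.sub (hu.smul _)
  · exact (hv.smul _).sub hv.dx.dx

theorem rapid_h₁ (α β : ℝ) (u v : 𝓢(ℝ, ℝ)) : Rapid (h₁ dx α β (toSmooth u) (toSmooth v)) := by
  have hw := rapid_xdgPot β u v
  have hn := rapid_xdgFields α β u v 1
  rw [h₁_eq]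
  exact (hw.mul ((hw.smul _).sub hw.dx.dx)).sub (hn.pow_succ 1)

theorem rapid_h₂ (α β : ℝ) (u v : 𝓢(ℝ, ℝ)) : Rapid (h₂ dx α β (toSmooth u) (toSmooth v)) := by
  have hw := rapid_xdgPot β u v
  have hn := rapid_xdgFields α β u v 1
  rw [h₂_eq]
  exact (hw.mul (((hw.dx.pow_succ 1).add ((hw.pow_succ 1).smul _)).sub (hn.pow_succ 1))).neg

theorem rapid_xdgSource (α β : ℝ) (u v : 𝓢(ℝ, ℝ)) :
    Rapid (xdgSource dx α β (toSmooth u) (toSmooth v)) := by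
  have hw := rapid_xdgPot β u v
  have hn := rapid_xdgFields α β u v 1
  exact (((hw.dx.pow_succ 1).add ((hw.mul hw.dx.dx).ofNat_mul 2)).sub
    (((hw.pow_succ 1).ofNat_mul 3).smul _)).add (hn.pow_succ 1)

theorem rapid_zero : Rapid 0 := ⟨0, rfl⟩

theorem Temperate.ofNat_mul {f : Smooth} (hf : Temperate f) (k : ℕ) [k.AtLeastTwo] :
    Temperate (ofNat(k) * f) := by
  have := hf.smul (OfNat.ofNat k)
  rwa [Algebra.smul_def, map_ofNat] at this

theorem isVarGradient_H₁ (α β : ℝ) (u v : 𝓢(ℝ, ℝ)) :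
    IsVarGradient (xdgFields dx α β) (H₁ α β) u v
      (xdgGrad₁ dx α β (toSmooth u) (toSmooth v)) := by
  have hw := rapid_xdgPot β u v
  have hn := rapid_xdgFields α β u v 1
  have e2 : algebraMap ℝ Smooth 2 = 2 := map_ofNat _ 2
  refine isVarGradient_of_expansion _ (h₁ dx α β) 2 u v _ (fun i => ?_) fun U V => ?_
  · refine Rapid.temperate ?_
    fin_cases i
    · exact hw.ofNat_mul 4
    · exact (((hw.smul _).ofNat_mul 8).sub (hw.dx.ofNat_mul 4)).sub (hn.ofNat_mul 4)
  have hW := rapid_xdgPot β U V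
  have hN := rapid_xdgFields α β U V 1
  simp only [h₁_eq, xdgPot_add_smul, xdgFields_one_add_smul, xdgFields_zero_eq, xdgGrad₁,
    Matrix.cons_val_zero, Matrix.cons_val_one, Matrix.cons_val_fin_one]
  generalize xdgPot dx β (toSmooth u) (toSmooth v) = w at *
  generalize xdgFields dx α β (toSmooth u) (toSmooth v) 1 = n at *
  generalize xdgPot dx β (toSmooth U) (toSmooth V) = W at *
  generalize xdgFields dx α β (toSmooth U) (toSmooth V) 1 = N at *
  generalize 4 * (α + β ^ 2) = c
  refine ⟨w * (c • w - dx (dx w)) - n ^ 2,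
    w * (c • W - dx (dx W)) + W * (c • w - dx (dx w)) - 2 * (n * N),
    W * (c • W - dx (dx W)) - N ^ 2, 0, 2 * (w * dx W - W * dx w) + 4 * (w * N),
    (hw.mul ((hw.smul _).sub hw.dx.dx)).sub (hn.pow_succ 1),
    ((hw.mul ((hW.smul _).sub hW.dx.dx)).add (hW.mul ((hw.smul _).sub hw.dx.dx))).sub
      ((hn.mul hN).ofNat_mul 2),
    (hW.mul ((hW.smul _).sub hW.dx.dx)).sub (hN.pow_succ 1), rapid_zero,
    (((hw.mul hW.dx).sub (hW.mul hw.dx)).ofNat_mul 2).add ((hw.mul hN).ofNat_mul 4),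
    fun ε => ?_, ?_⟩
  · simp [Algebra.smul_def]
    ring
  · simp [Algebra.smul_def, derivation_ofNat, e2]
    ring

theorem isVarGradient_H₂ (α β : ℝ) (u v : 𝓢(ℝ, ℝ)) {G : Smooth} (hGt : Temperate G)
    (hG : dx (dx G) = (4 * (α + β ^ 2)) • G - xdgSource dx α β (toSmooth u) (toSmooth v)) :
    IsVarGradient (xdgFields dx α β) (H₂ α β) u v
      (xdgGrad₂ dx α β (toSmooth u) (toSmooth v) G) := by
  have hw := rapid_xdgPot β u v
  have hn := rapid_xdgFields α β u v 1
  have e2 : algebraMap ℝ Smooth 2 = 2 := map_ofNat _ 2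
  refine isVarGradient_of_expansion _ (h₂ dx α β) 2 u v _ (fun i => ?_) fun U V => ?_
  · fin_cases i
    · exact hGt.ofNat_mul 2
    · exact (((hGt.smul _).ofNat_mul 4).sub (hGt.dx.ofNat_mul 2)).add
        ((hw.mul hn).ofNat_mul 4).temperate
  have hW := rapid_xdgPot β U V
  have hN := rapid_xdgFields α β U V 1
  simp only [h₂_eq, xdgPot_add_smul, xdgFields_one_add_smul, xdgFields_zero_eq, xdgGrad₂,
    xdgSource, Matrix.cons_val_zero, Matrix.cons_val_one, Matrix.cons_val_fin_one] at hG ⊢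
  generalize xdgPot dx β (toSmooth u) (toSmooth v) = w at *
  generalize xdgFields dx α β (toSmooth u) (toSmooth v) 1 = n at *
  generalize xdgPot dx β (toSmooth U) (toSmooth V) = W at *
  generalize xdgFields dx α β (toSmooth U) (toSmooth V) 1 = N at *
  generalize 4 * (α + β ^ 2) = c at *
  -- The quadratic form `w'² + c w² - n²`, its polarisation and its values on the variation.
  have hq : Rapid (dx w ^ 2 + c • w ^ 2 - n ^ 2) :=
    ((hw.dx.pow_succ 1).add ((hw.pow_succ 1).smul _)).sub (hn.pow_succ 1)
  have hp : Rapid (2 * (dx w * dx W + c • (w * W) - n * N)) :=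
    (((hw.dx.mul hW.dx).add ((hw.mul hW).smul _)).sub (hn.mul hN)).ofNat_mul 2
  have hQ : Rapid (dx W ^ 2 + c • W ^ 2 - N ^ 2) :=
    ((hW.dx.pow_succ 1).add ((hW.pow_succ 1).smul _)).sub (hN.pow_succ 1)
  refine ⟨_, _, _, _,
    2 * (G * dx W - dx G * W) + 2 * (G * N) - 4 * (w * dx w * W),
    (hw.mul hq).neg, ((hW.mul hq).add (hw.mul hp)).neg, ((hW.mul hp).add (hw.mul hQ)).neg,
    (hW.mul hQ).neg,
    ((((Rapid.temperate_mul hGt hW.dx).sub (Rapid.temperate_mul hGt.dx hW)).ofNat_mul 2).add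
      ((Rapid.temperate_mul hGt hN).ofNat_mul 2)).sub (((hw.mul hw.dx).mul hW).ofNat_mul 4),
    fun ε => ?_, ?_⟩
  · simp [Algebra.smul_def]
    ring
  · simp [Algebra.smul_def, derivation_ofNat, e2] at hG ⊢
    linear_combination 2 * W * hG

theorem xdg_gradient_unique {α β : ℝ} (hc : 0 < α + β ^ 2) {H : 𝓢(ℝ, ℝ) → 𝓢(ℝ, ℝ) → ℝ}
    {u v : 𝓢(ℝ, ℝ)} {g g' : Fin 2 → Smooth} (h : IsVarGradient (xdgFields dx α β) H u v g)
    (h' : IsVarGradient (xdgFields dx α β) H u v g') : g = g' := by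
  have hc' : 0 < 4 * (α + β ^ 2) := by linarith
  have key := h.integral_sub_eq_zero (rapid_xdgFields α β) h'
  ext1 i
  refine sub_eq_zero.1 (eq_zero_of_integral_mul_ode_eq_zero ((h.1 i).sub (h'.1 i)) hc' fun U => ?_)
  fin_cases i
  · rw [← key U 0]
    simp [xdgFields, toSmooth_zero]
  · rw [← key 0 (-U)]
    have : toSmooth (-U) = -toSmooth U := rfl
    simp [xdgFields, toSmooth_zero, this, sub_eq_add_neg, add_comm]

theorem exists_xdgGrad₂ (α β : ℝ) (u v : 𝓢(ℝ, ℝ)) :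
    ∃ g : Fin 2 → Smooth, IsVarGradient (xdgFields dx α β) (H₂ α β) u v g ∧
      act (E₂ dx α β) g = xdgRHS dx α β (toSmooth u) (toSmooth v) := by
  obtain ⟨G, hGt, hG⟩ := exists_temperate_ode (4 * (α + β ^ 2)) (rapid_xdgSource α β u v)
  exact ⟨_, isVarGradient_H₂ α β u v hGt hG, act_E₂_xdgGrad₂ dx α β _ _ G hG⟩

theorem rapid_chFields (q ρ : 𝓢(ℝ, ℝ)) (i : Fin 2) :
    Rapid (chFields dx (toSmooth q) (toSmooth ρ) i) := by
  fin_cases i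
  · exact (rapid_toSmooth q).sub (rapid_toSmooth q).dx.dx
  · exact rapid_toSmooth ρ

theorem rapid_chSource (q ρ : 𝓢(ℝ, ℝ)) : Rapid (chSource dx (toSmooth q) (toSmooth ρ)) := by
  have hq := rapid_toSmooth q
  exact ((((hq.pow_succ 1).ofNat_mul 3).sub (hq.dx.pow_succ 1)).sub
    ((hq.mul hq.dx.dx).ofNat_mul 2)).sub ((rapid_toSmooth ρ).pow_succ 1)

theorem isVarGradient_chH₁ (q ρ : 𝓢(ℝ, ℝ)) :
    IsVarGradient (chFields dx) chH₁ q ρ ![toSmooth q, -toSmooth ρ] := by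
  have hq := rapid_toSmooth q
  have hρ := rapid_toSmooth ρ
  have e : 2 * algebraMap ℝ Smooth 2⁻¹ = 1 := by
    rw [← map_ofNat (algebraMap ℝ Smooth) 2, ← map_mul]; simp
  refine isVarGradient_of_expansion _ (chDensity₁ dx) (1 / 2) q ρ _ (fun i => ?_) fun U V => ?_
  · fin_cases i
    · exact hq.temperate
    · exact hρ.neg.temperate
  have hQ := rapid_toSmooth U
  have hR := rapid_toSmooth V
  simp only [chDensity₁, chFields, Matrix.cons_val_zero, Matrix.cons_val_one,
    Matrix.cons_val_fin_one]
  generalize toSmooth q = q at *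
  generalize toSmooth ρ = ρ at *
  generalize toSmooth U = Q at *
  generalize toSmooth V = R at *
  refine ⟨q * (q - dx (dx q)) - ρ ^ 2,
    q * (Q - dx (dx Q)) + Q * (q - dx (dx q)) - 2 * (ρ * R), Q * (Q - dx (dx Q)) - R ^ 2, 0,
    (1 / 2 : ℝ) • (q * dx Q - Q * dx q),
    (hq.mul (hq.sub hq.dx.dx)).sub (hρ.pow_succ 1),
    ((hq.mul (hQ.sub hQ.dx.dx)).add (hQ.mul (hq.sub hq.dx.dx))).sub ((hρ.mul hR).ofNat_mul 2),
    (hQ.mul (hQ.sub hQ.dx.dx)).sub (hR.pow_succ 1), rapid_zero,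
    ((hq.mul hQ.dx).sub (hQ.mul hq.dx)).smul _, fun ε => ?_, ?_⟩
  · simp [Algebra.smul_def]
    ring
  · simp [Algebra.smul_def]
    linear_combination (q * (Q - dx (dx Q)) - ρ * R) * e

theorem isVarGradient_chH₂ (q ρ : 𝓢(ℝ, ℝ)) {G : Smooth} (hGt : Temperate G)
    (hG : dx (dx G) = (1 : ℝ) • G - (1 / 2 : ℝ) • chSource dx (toSmooth q) (toSmooth ρ)) :
    IsVarGradient (chFields dx) chH₂ q ρ ![G, -(toSmooth q * toSmooth ρ)] := by
  have hq := rapid_toSmooth q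
  have hρ := rapid_toSmooth ρ
  have e : 2 * algebraMap ℝ Smooth 2⁻¹ = 1 := by
    rw [← map_ofNat (algebraMap ℝ Smooth) 2, ← map_mul]; simp
  refine isVarGradient_of_expansion _ (chDensity₂ dx) (1 / 2) q ρ _ (fun i => ?_) fun U V => ?_
  · fin_cases i
    · exact hGt
    · exact (hq.mul hρ).neg.temperate
  have hQ := rapid_toSmooth U
  have hR := rapid_toSmooth V
  simp only [chDensity₂, chSource, chFields, Matrix.cons_val_zero, Matrix.cons_val_one,
    Matrix.cons_val_fin_one] at hG ⊢
  generalize toSmooth q = q at *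
  generalize toSmooth ρ = ρ at *
  generalize toSmooth U = Q at *
  generalize toSmooth V = R at *
  have hf : Rapid (q ^ 2 + dx q ^ 2 - ρ ^ 2) :=
    ((hq.pow_succ 1).add (hq.dx.pow_succ 1)).sub (hρ.pow_succ 1)
  have hp : Rapid (2 * (q * Q + dx q * dx Q - ρ * R)) :=
    (((hq.mul hQ).add (hq.dx.mul hQ.dx)).sub (hρ.mul hR)).ofNat_mul 2
  have hF : Rapid (Q ^ 2 + dx Q ^ 2 - R ^ 2) :=
    ((hQ.pow_succ 1).add (hQ.dx.pow_succ 1)).sub (hR.pow_succ 1)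
  refine ⟨_, _, _, _, G * dx Q - dx G * Q + q * dx q * Q,
    hq.mul hf, (hQ.mul hf).add (hq.mul hp), (hQ.mul hp).add (hq.mul hF), hQ.mul hF,
    ((Rapid.temperate_mul hGt hQ.dx).sub (Rapid.temperate_mul hGt.dx hQ)).add
      ((hq.mul hq.dx).mul hQ), fun ε => ?_, ?_⟩
  · simp [Algebra.smul_def]
    ring
  · simp [Algebra.smul_def] at hG ⊢
    linear_combination Q * hG + (dx q ^ 2 * Q + q * dx (dx q) * Q + q * dx q * dx Q - ρ * q * R) * e

theorem ch_gradient_unique {H : 𝓢(ℝ, ℝ) → 𝓢(ℝ, ℝ) → ℝ} {q ρ : 𝓢(ℝ, ℝ)}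
    {g g' : Fin 2 → Smooth} (h : IsVarGradient (chFields dx) H q ρ g)
    (h' : IsVarGradient (chFields dx) H q ρ g') : g = g' := by
  have key := h.integral_sub_eq_zero rapid_chFields h'
  ext1 i
  rw [← sub_eq_zero]
  fin_cases i
  · refine eq_zero_of_integral_mul_ode_eq_zero ((h.1 0).sub (h'.1 0)) one_pos fun U => ?_
    rw [← key (-U) 0]
    have : toSmooth (-U) = -toSmooth U := rfl
    simp [chFields, toSmooth_zero, this, sub_eq_add_neg, add_comm]
  · refine Temperate.eq_zero_of_integral_eq_zero _ fun V => ?_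
    rw [← key 0 V]
    simp [chFields, toSmooth_zero]

theorem exists_chGrad₂ (q ρ : 𝓢(ℝ, ℝ)) :
    ∃ g : Fin 2 → Smooth, IsVarGradient (chFields dx) chH₂ q ρ g ∧
      act (B₂ dx) g = chRHS dx (toSmooth q) (toSmooth ρ) := by
  obtain ⟨G, hGt, hG⟩ := exists_temperate_ode 1 ((rapid_chSource q ρ).smul (1 / 2))
  exact ⟨_, isVarGradient_chH₂ q ρ hGt hG, act_B₂_chGrad dx _ _ G hG⟩

/-- If at each point some variational gradient is mapped by `E` to the vector field `F`, then
every integral curve of `F` is a Hamiltonian flow. -/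
theorem isHamiltonianFlow_of_evolves {Λ : Smooth → Smooth → Fin 2 → Smooth}
    {E : (Fin 2 → Smooth) → Matrix (Fin 2) (Fin 2) (Module.End ℝ Smooth)}
    {H : 𝓢(ℝ, ℝ) → 𝓢(ℝ, ℝ) → ℝ} {F : 𝓢(ℝ, ℝ) → 𝓢(ℝ, ℝ) → Fin 2 → Smooth}
    (hF : ∀ u v, ∃ g, IsVarGradient Λ H u v g ∧
      act (E (Λ (toSmooth u) (toSmooth v))) g = F u v)
    {u v : ℝ → 𝓢(ℝ, ℝ)} (h : Evolves Λ (fun t => F (u t) (v t)) u v) :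
    IsHamiltonianFlow Λ E H u v := by
  choose g hg hgF using hF
  refine ⟨fun t => g (u t) (v t), fun t => hg _ _, ?_⟩
  simpa only [hgF] using h

/-- The converse of `isHamiltonianFlow_of_evolves`, when variational gradients are unique. -/
theorem evolves_of_isHamiltonianFlow {Λ : Smooth → Smooth → Fin 2 → Smooth}
    {E : (Fin 2 → Smooth) → Matrix (Fin 2) (Fin 2) (Module.End ℝ Smooth)}
    {H : 𝓢(ℝ, ℝ) → 𝓢(ℝ, ℝ) → ℝ} {F : 𝓢(ℝ, ℝ) → 𝓢(ℝ, ℝ) → Fin 2 → Smooth}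
    (hF : ∀ u v, ∃ g, IsVarGradient Λ H u v g ∧
      act (E (Λ (toSmooth u) (toSmooth v))) g = F u v)
    (huniq : ∀ {u v g g'}, IsVarGradient Λ H u v g → IsVarGradient Λ H u v g' → g = g')
    {u v : ℝ → 𝓢(ℝ, ℝ)} (h : IsHamiltonianFlow Λ E H u v) :
    Evolves Λ (fun t => F (u t) (v t)) u v := by
  obtain ⟨g, hg, he⟩ := h
  have e (t : ℝ) : act (E (Λ (toSmooth (u t)) (toSmooth (v t)))) (g t) = F (u t) (v t) := by
    obtain ⟨g', hg', hF'⟩ := hF (u t) (v t)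
    rw [huniq (hg t) hg', hF']
  simpa only [e] using he

end SchwartzFields

end XDG

theorem mainTheorem1 {𝕜 : Type*} [Field 𝕜] [CharZero 𝕜] :
    -- `E₁`, `E₂` are a compatible pair of Hamiltonian operators, and so are the rescaled pair and
    -- the pair `B₁`, `B₂`, which are related by `Bᵢ = M Eᵢ M†`.
    ((∀ α β : 𝕜, IsHamiltonianPair (E₁ (D 𝕜) (fld 𝕜 0) (fld 𝕜 1)) (E₂ (D 𝕜) α β)) ∧
      IsHamiltonianPair (B₁ (D 𝕜) (fld 𝕜 0) (fld 𝕜 1)) (B₂ (D 𝕜)) ∧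
      (∀ α β κ : 𝕜, κ ≠ 0 → κ ^ 2 = 4 * (α + β ^ 2) →
        IsHamiltonianPair (E₁ (D 𝕜) (fld 𝕜 0) (fld 𝕜 1)) (E₂scaled (D 𝕜) α β κ) ∧
        frechet (miuraMap (D 𝕜) β κ (fld 𝕜 0) (fld 𝕜 1)) = miuraOp (D 𝕜) β κ ∧
        IsFormalAdjoint (miuraOp (D 𝕜) β κ) (miuraOpAdj (D 𝕜) β κ) ∧
        B₁ (D 𝕜) (miuraMap (D 𝕜) β κ (fld 𝕜 0) (fld 𝕜 1) 0)
            (miuraMap (D 𝕜) β κ (fld 𝕜 0) (fld 𝕜 1) 1) =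
          miuraOp (D 𝕜) β κ * E₁ (D 𝕜) (fld 𝕜 0) (fld 𝕜 1) * miuraOpAdj (D 𝕜) β κ ∧
        B₂ (D 𝕜) = miuraOp (D 𝕜) β κ * E₂scaled (D 𝕜) α β κ * miuraOpAdj (D 𝕜) β κ)) ∧
    -- The XDG system is bi-Hamiltonian.
    (∀ α β : ℝ,
      (∀ u v : 𝓢(ℝ, ℝ),
        Integrable (h₁ dx α β (toSmooth u) (toSmooth v)).1 ∧
        Integrable (h₂ dx α β (toSmooth u) (toSmooth v)).1 ∧
        ∃ g₁ g₂ : Fin 2 → Smooth,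
          IsVarGradient (xdgFields dx α β) (H₁ α β) u v g₁ ∧
          IsVarGradient (xdgFields dx α β) (H₂ α β) u v g₂ ∧
          act (E₁ dx (xdgFields dx α β (toSmooth u) (toSmooth v) 0)
              (xdgFields dx α β (toSmooth u) (toSmooth v) 1)) g₁ =
            xdgRHS dx α β (toSmooth u) (toSmooth v) ∧
          act (E₂ dx α β) g₂ = xdgRHS dx α β (toSmooth u) (toSmooth v) ∧
          (0 < α + β ^ 2 →
            (∀ g, IsVarGradient (xdgFields dx α β) (H₁ α β) u v g → g = g₁) ∧
            (∀ g, IsVarGradient (xdgFields dx α β) (H₂ α β) u v g → g = g₂))) ∧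
      (∀ u v : ℝ → 𝓢(ℝ, ℝ), IsXDGSolution α β u v →
        IsHamiltonianFlow (xdgFields dx α β) (fun f => E₁ dx (f 0) (f 1)) (H₁ α β) u v ∧
        IsHamiltonianFlow (xdgFields dx α β) (fun _ => E₂ dx α β) (H₂ α β) u v) ∧
      (0 < α + β ^ 2 → ∀ u v : ℝ → 𝓢(ℝ, ℝ),
        (IsHamiltonianFlow (xdgFields dx α β) (fun f => E₁ dx (f 0) (f 1)) (H₁ α β) u v →
          IsXDGSolution α β u v) ∧
        (IsHamiltonianFlow (xdgFields dx α β) (fun _ => E₂ dx α β) (H₂ α β) u v →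
          IsXDGSolution α β u v))) ∧
    -- `B₁`, `B₂` are the Hamiltonian operators of the 2-CH equation.
    (∀ q ρ : ℝ → 𝓢(ℝ, ℝ),
      (IsCHSolution q ρ ↔
        IsHamiltonianFlow (chFields dx) (fun f => B₁ dx (f 0) (f 1)) chH₁ q ρ) ∧
      (IsCHSolution q ρ ↔
        IsHamiltonianFlow (chFields dx) (fun _ => B₂ dx) chH₂ q ρ)) := by
  have hE₁ (α β : ℝ) (u v : 𝓢(ℝ, ℝ)) : ∃ g : Fin 2 → Smooth,
      IsVarGradient (xdgFields dx α β) (H₁ α β) u v g ∧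
      act (E₁ dx (xdgFields dx α β (toSmooth u) (toSmooth v) 0)
        (xdgFields dx α β (toSmooth u) (toSmooth v) 1)) g =
          xdgRHS dx α β (toSmooth u) (toSmooth v) :=
    ⟨_, isVarGradient_H₁ α β u v, act_E₁_xdgGrad₁ dx α β _ _⟩
  have hB₁ (q ρ : 𝓢(ℝ, ℝ)) : ∃ g : Fin 2 → Smooth, IsVarGradient (chFields dx) chH₁ q ρ g ∧
      act (B₁ dx (chFields dx (toSmooth q) (toSmooth ρ) 0)
        (chFields dx (toSmooth q) (toSmooth ρ) 1)) g = chRHS dx (toSmooth q) (toSmooth ρ) :=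
    ⟨_, isVarGradient_chH₁ q ρ, act_B₁_chGrad dx _ _⟩
  have hE₂ := exists_xdgGrad₂
  have hB₂ := exists_chGrad₂
  let FX (α β : ℝ) (u v : 𝓢(ℝ, ℝ)) := xdgRHS dx α β (toSmooth u) (toSmooth v)
  let FC (q ρ : 𝓢(ℝ, ℝ)) := chRHS dx (toSmooth q) (toSmooth ρ)
  refine ⟨⟨isHamiltonianPair_E₁_E₂, isHamiltonianPair_B₁_B₂, fun α β κ hκ h =>
    ⟨isHamiltonianPair_E₁_E₂scaled α β κ, frechet_miuraMap β κ, isFormalAdjoint_miuraOp β κ,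
      B₁_miuraMap _ β κ _ _, B₂_eq_miuraOp _ hκ h⟩⟩, fun α β => ⟨fun u v => ?_, ?_, ?_⟩,
    fun q ρ => ⟨⟨?_, ?_⟩, ⟨?_, ?_⟩⟩⟩
  · obtain ⟨g₁, hg₁, e₁⟩ := hE₁ α β u v
    obtain ⟨g₂, hg₂, e₂⟩ := hE₂ α β u v
    exact ⟨(rapid_h₁ α β u v).integrable, (rapid_h₂ α β u v).integrable, g₁, g₂, hg₁, hg₂, e₁,
      e₂, fun hc => ⟨fun g hg => xdg_gradient_unique hc hg hg₁,
        fun g hg => xdg_gradient_unique hc hg hg₂⟩⟩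
  · exact fun u v h => ⟨
      isHamiltonianFlow_of_evolves (E := fun f => E₁ dx (f 0) (f 1)) (F := FX α β) (hE₁ α β) h,
      isHamiltonianFlow_of_evolves (E := fun _ => E₂ dx α β) (F := FX α β) (hE₂ α β) h⟩
  · exact fun hc u v => ⟨
      evolves_of_isHamiltonianFlow (E := fun f => E₁ dx (f 0) (f 1)) (F := FX α β) (hE₁ α β)
        (xdg_gradient_unique hc),
      evolves_of_isHamiltonianFlow (E := fun _ => E₂ dx α β) (F := FX α β) (hE₂ α β)
        (xdg_gradient_unique hc)⟩
  · exact isHamiltonianFlow_of_evolves (E := fun f => B₁ dx (f 0) (f 1)) (F := FC) hB₁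
  · exact evolves_of_isHamiltonianFlow (E := fun f => B₁ dx (f 0) (f 1)) (F := FC) hB₁
      ch_gradient_unique
  · exact isHamiltonianFlow_of_evolves (E := fun _ => B₂ dx) (F := FC) hB₂
  · exact evolves_of_isHamiltonianFlow (E := fun _ => B₂ dx) (F := FC) hB₂ ch_gradient_unique
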